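/- Let $M$ be a one-dimensional complex manifold with a Kähler metric, given in each holomorphic coordinate $z$ by a smooth positive function $g_{1\bar 1}$ that transforms as a Hermitian tensor and locally has a real Kähler potential: $g_{1\bar1}=\partial_z\partial_{\bar z}\Phi$. Put $g^{1\bar1}=1/g_{1\bar1}$. Assume that $M$ is locally symmetric, i.e. the covariant derivative of the curvature tensor vanishes, $\nabla_m R_{ijk}{}^l=0$ for all $i,j,k,l,m\in\{1,\bar1\}$, where $R_{ijk}{}^l=\partial_i\Gamma^l_{jk}-\partial_j\Gamma^l_{ik}+\Gamma^n_{jk}\Gamma^l_{in}-\Gamma^n_{ik}\Gamma^l_{jn}$ and the only nonzero Christoffel symbols are $\Gamma^1_{11}=g^{1\bar1}\partial_z g_{1\bar1}$ and $\Gamma^{\bar1}_{\bar1\bar1}=g^{1\bar1}\partial_{\bar z}g_{1\bar1}$. A star product is an associative product $f*g=\sum_{n\ge0}\hbar^nC_n(f,g)$ on $C^\infty(M)[[\hbar]]$ (complex-valued smooth functions), with $C_n$ bidifferential operators extended $\hbar$-bilinearly, such that $C_0(f,g)=fg$, $C_1(f,g)-C_1(g,f)=\{f,g\}:=g^{1\bar1}(\partial_{\bar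 z}f\,\partial_zg-\partial_zf\,\partial_{\bar z}g)$ and $f*1=1*f=f$. By "the star product with separation of variables of $M$" we mean a star product such that, on open subsets of $M$, $a*f=af$ for $a$ holomorphic, $f*b=fb$ for $b$ antiholomorphic, and the operator $L_f\colon u\mapsto f*u$ commutes with $\partial_{\bar z}\Phi+\hbar\,\partial_{\bar z}$ for every local Kähler potential $\Phi$ and every $f$. Then there is exactly one star product with separation of variables of $M$. The component $$R=R_{\bar1}{}^{\bar1\bar1}{}_{\bar1}=g^{1\bar1}g^{1\bar1}R_{\bar1 1 1\bar1},\qquad R_{\bar1 1 1\bar1}=g_{1\bar1}R_{\bar1 1 1}{}^{1},$$ is a real, locally constant function on $M$, independent of the coordinate (hence a constant if $M$ is connected). For all smooth functions $f,g$ on $M$, in every holomorphic coordinate $z$, $$f*g=\sum_{n=0}^\infty T^n\,\Big\{\big(g^{1\bar1}\partial_{\bar z}\big)^nf\Big\}\Big\{\big(g^{1\bar1}\partial_z\big)^ng\Big\},\qquad T^n=(g_{1\bar1})^n\prod_{k=1}^{n}\frac{2\hbar}{2k+\hbar k(k-1)R},$$ where the fractions are expanded as formal power series in $\hbar$. The coefficients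 satisfy $T^0=1$ and $$T^n=g_{1\bar1}\,\frac{2\hbar}{2n+\hbar n(n-1)R}\,T^{n-1}\qquad(n\ge1).$$ -/

import Mathlib

open scoped Manifold ContDiff PowerSeries PowerSeries.WithPiTopology

noncomputable section

namespace KahlerStar

/-! ### Wirtinger calculus in one complex coordinate -/

/-- `∂φ/∂z = (∂φ/∂x - i ∂φ/∂y) / 2`. -/
def dz (φ : ℂ → ℂ) (z : ℂ) : ℂ :=
  (fderiv ℝ φ z 1 - Complex.I * fderiv ℝ φ z Complex.I) / 2

/-- `∂φ/∂z̄ = (∂φ/∂x + i ∂φ/∂y) / 2`. -/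
def dzbar (φ : ℂ → ℂ) (z : ℂ) : ℂ :=
  (fderiv ℝ φ z 1 + Complex.I * fderiv ℝ φ z Complex.I) / 2

/-- The coordinate derivative `∂_i`, where the index `i = 0` stands for the holomorphic index `1`
and the index `i = 1` stands for the antiholomorphic index `1̄`. -/
def wirt (i : Fin 2) (φ : ℂ → ℂ) : ℂ → ℂ :=
  if i = 0 then dz φ else dzbar φ

/-! ### Connection and curvature of the Kähler metric `h = g_{1 1̄}` in one coordinate

All indices run over `Fin 2`, with `0` for `1` and `1` for `1̄`. -/

/-- Christoffel symbol `Γ^l_{jk}` : the only nonzero ones are `Γ^1_{11} = h⁻¹ ∂h` and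
`Γ^{1̄}_{1̄1̄} = h⁻¹ ∂̄h`. -/
def christoffel (h : ℂ → ℂ) (l j k : Fin 2) (z : ℂ) : ℂ :=
  if l = j ∧ j = k then (h z)⁻¹ * wirt l h z else 0

/-- `R_{ijk}^l = ∂_i Γ^l_{jk} - ∂_j Γ^l_{ik} + Γ^n_{jk} Γ^l_{in} - Γ^n_{ik} Γ^l_{jn}`. -/
def riemann (h : ℂ → ℂ) (i j k l : Fin 2) (z : ℂ) : ℂ :=
  wirt i (christoffel h l j k) z - wirt j (christoffel h l i k) z
    + ∑ n, (christoffel h n j k z * christoffel h l i n z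
      - christoffel h n i k z * christoffel h l j n z)

/-- The covariant derivative `∇_m R_{ijk}^l`. -/
def covRiemann (h : ℂ → ℂ) (m i j k l : Fin 2) (z : ℂ) : ℂ :=
  wirt m (riemann h i j k l) z
    + ∑ s, (christoffel h l m s z * riemann h i j k s z
      - christoffel h s m i z * riemann h s j k l z
      - christoffel h s m j z * riemann h i s k l z
      - christoffel h s m k z * riemann h i j s l z)

/-- `R_{1̄}^{1̄ 1̄}_{1̄} = g^{1 1̄} g^{1 1̄} R_{1̄ 1 1 1̄}`, where `R_{1̄ 1 1 1̄} = R_{1̄ 1 1}^1 g_{1 1̄}`. -/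
def curvatureComponent (h : ℂ → ℂ) (z : ℂ) : ℂ :=
  (h z)⁻¹ * (h z)⁻¹ * (riemann h 1 0 0 0 z * h z)

/-! ### Kähler metrics on a one-dimensional complex manifold -/

section Manifold

variable (M : Type*) [TopologicalSpace M] [ChartedSpace ℂ M]

/-- `e` is a holomorphic coordinate chart of `M` (any chart of the maximal holomorphic atlas). -/
abbrev IsHolChart (e : OpenPartialHomeomorph M ℂ) : Prop :=
  e ∈ IsManifold.maximalAtlas 𝓘(ℂ) ω M

/-- A Kähler metric on a one-dimensional complex manifold, through its components
`g_{1 1̄} = coeff e` in the holomorphic charts `e` (a function on `e.target`): they are smooth and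
positive, transform as a Hermitian tensor, and locally have a real Kähler potential `Φ`, that is,
`g_{1 1̄} = ∂ ∂̄ Φ`. Values of `coeff` outside of `e.target` carry no meaning. -/
structure KahlerMetric where
  coeff : OpenPartialHomeomorph M ℂ → ℂ → ℝ
  smooth : ∀ e, IsHolChart M e → ContDiffOn ℝ ∞ (coeff e) e.target
  pos : ∀ e, IsHolChart M e → ∀ z ∈ e.target, 0 < coeff e z
  transform : ∀ e e', IsHolChart M e → IsHolChart M e' → ∀ z ∈ (e.symm ≫ₕ e').source,
    coeff e z = coeff e' (e' (e.symm z)) * ‖deriv (fun w => e' (e.symm w)) z‖ ^ 2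
  potential : ∀ e, IsHolChart M e → ∀ z₀ ∈ e.target, ∃ V : Set ℂ, IsOpen V ∧ z₀ ∈ V ∧
    V ⊆ e.target ∧ ∃ Φ : ℂ → ℝ, ContDiffOn ℝ ∞ Φ V ∧
      ∀ z ∈ V, dz (dzbar fun w => (Φ w : ℂ)) z = (coeff e z : ℂ)

variable {M}

/-- The component `g_{1 1̄}` in the chart `e`, as a complex valued function. -/
def KahlerMetric.g (G : KahlerMetric M) (e : OpenPartialHomeomorph M ℂ) (z : ℂ) : ℂ :=
  (G.coeff e z : ℂ)

/-- `∇_m R_{ijk}^l = 0` for all indices, in all charts. -/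
def KahlerMetric.IsLocallySymmetric (G : KahlerMetric M) : Prop :=
  ∀ e, IsHolChart M e → ∀ z ∈ e.target, ∀ m i j k l : Fin 2, covRiemann (G.g e) m i j k l z = 0

/-- The operator `D^{1̄} = g^{1 1̄} ∂` in the chart `e`. -/
def KahlerMetric.D (G : KahlerMetric M) (e : OpenPartialHomeomorph M ℂ) (φ : ℂ → ℂ) (z : ℂ) : ℂ :=
  (G.g e z)⁻¹ * dz φ z

/-- The operator `D^1 = g^{1 1̄} ∂̄` in the chart `e`. -/
def KahlerMetric.Dbar (G : KahlerMetric M) (e : OpenPartialHomeomorph M ℂ) (φ : ℂ → ℂ) (z : ℂ) :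
    ℂ :=
  (G.g e z)⁻¹ * dzbar φ z

/-! ### Smooth functions, formal power series and star products -/

variable (M)

/-- The algebra `C^∞(M)` of complex valued functions, smooth in the real sense. -/
def SmoothFun : Subalgebra ℂ (M → ℂ) where
  carrier := {f | ContMDiff 𝓘(ℝ, ℂ) 𝓘(ℝ, ℂ) ∞ f}
  mul_mem' {f g} hf hg := by
    have h : ContMDiff 𝓘(ℝ, ℂ × ℂ) 𝓘(ℝ, ℂ) ∞ fun p : ℂ × ℂ => p.1 * p.2 :=
      (contDiff_fst.mul contDiff_snd).contMDiff
    exact h.comp (hf.prodMk_space hg)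
  add_mem' {f g} hf hg := by
    have h : ContMDiff 𝓘(ℝ, ℂ × ℂ) 𝓘(ℝ, ℂ) ∞ fun p : ℂ × ℂ => p.1 + p.2 :=
      (contDiff_fst.add contDiff_snd).contMDiff
    exact h.comp (hf.prodMk_space hg)
  algebraMap_mem' _ := contMDiff_const

variable {M}

/-- The coordinate expression of a function on `M` in the chart `e`. -/
def inChart (e : OpenPartialHomeomorph M ℂ) (f : SmoothFun M) (z : ℂ) : ℂ :=
  (f : M → ℂ) (e.symm z)

/-- A bilinear map on `C^∞(M)` is a bidifferential operator (of order at most some `N` in each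
argument, with smooth coefficients in every chart). -/
def IsBidifferential (B : SmoothFun M →ₗ[ℂ] SmoothFun M →ₗ[ℂ] SmoothFun M) : Prop :=
  ∃ N : ℕ, ∀ e, IsHolChart M e → ∃ a : ℕ → ℕ → ℕ → ℕ → ℂ → ℂ,
    (∀ i j k l, ContDiffOn ℝ ∞ (a i j k l) e.target) ∧
    ∀ f g : SmoothFun M, ∀ z ∈ e.target,
      inChart e (B f g) z =
        ∑ i ∈ Finset.range (N + 1), ∑ j ∈ Finset.range (N + 1),
          ∑ k ∈ Finset.range (N + 1), ∑ l ∈ Finset.range (N + 1),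
            a i j k l z * (dz^[i] (dzbar^[j] (inChart e f))) z
              * (dz^[k] (dzbar^[l] (inChart e g))) z

/-- The product `f * g = ∑_n C_n(f, g) ħ^n` on `C^∞(M)[[ħ]]`, with `C_n` extended
`ħ`-bilinearly. The variable `PowerSeries.X` plays the role of `ħ`. -/
def starProd (C : ℕ → SmoothFun M →ₗ[ℂ] SmoothFun M →ₗ[ℂ] SmoothFun M)
    (f g : (SmoothFun M)⟦X⟧) : (SmoothFun M)⟦X⟧ :=
  PowerSeries.mk fun n =>
    ∑ x ∈ Finset.HasAntidiagonal.antidiagonal n,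
      ∑ y ∈ Finset.HasAntidiagonal.antidiagonal x.2,
        C x.1 (PowerSeries.coeff y.1 f) (PowerSeries.coeff y.2 g)

/-- The value at `p ∈ M` of an element of `C^∞(M)[[ħ]]`, a formal power series in `ℂ[[ħ]]`. -/
def evalAt (p : M) (f : (SmoothFun M)⟦X⟧) : ℂ⟦X⟧ :=
  PowerSeries.mk fun n => ((PowerSeries.coeff n f : SmoothFun M) : M → ℂ) p

/-- `C = (C_n)` defines the star product with separation of variables of the Kähler metric `G`:
a deformation quantization with separation of variables such that the operators
`L_f : g ↦ f * g` commute with `R_{∂̄Φ} = ∂̄Φ + ħ ∂̄` for all local Kähler potentials `Φ`.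

A star product is local, so it acts on functions defined on an open set only; there may be no
nonconstant global holomorphic functions, so the separation conditions and the commutation
relation are imposed on open subsets of `M`, for global smooth functions that have the required
form on the open subset. -/
structure IsStarProductWithSeparation (G : KahlerMetric M)
    (C : ℕ → SmoothFun M →ₗ[ℂ] SmoothFun M →ₗ[ℂ] SmoothFun M) : Prop where
  assoc : ∀ f g h, starProd C (starProd C f g) h = starProd C f (starProd C g h)
  bidifferential : ∀ n, IsBidifferential (C n)
  zero_eq : ∀ f g, C 0 f g = f * g
  /-- `C_1(f, g) - C_1(g, f)` is the Poisson bracket `g^{1 1̄} (∂̄f ∂g - ∂f ∂̄g)`. -/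
  poisson : ∀ e, IsHolChart M e → ∀ f g, ∀ z ∈ e.target,
    inChart e (C 1 f g - C 1 g f) z =
      (G.g e z)⁻¹ * (dzbar (inChart e f) z * dz (inChart e g) z
        - dz (inChart e f) z * dzbar (inChart e g) z)
  one_star : ∀ f, starProd C 1 f = f
  star_one : ∀ f, starProd C f 1 = f
  /-- `a * f = a f` where `a` is holomorphic. -/
  holomorphic : ∀ (U : Set M) (a : SmoothFun M), IsOpen U →
    MDifferentiableOn 𝓘(ℂ) 𝓘(ℂ) (a : M → ℂ) U →
      ∀ f, ∀ p ∈ U, evalAt p (starProd C (PowerSeries.C a) f) = evalAt p (PowerSeries.C a * f)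
  /-- `f * b = f b` where `b` is antiholomorphic. -/
  antiholomorphic : ∀ (U : Set M) (b : SmoothFun M), IsOpen U →
    MDifferentiableOn 𝓘(ℂ) 𝓘(ℂ) (fun p => (starRingEnd ℂ) ((b : M → ℂ) p)) U →
      ∀ f, ∀ p ∈ U, evalAt p (starProd C f (PowerSeries.C b)) = evalAt p (f * PowerSeries.C b)
  /-- `L_f (∂̄Φ u + ħ ∂̄u) = (∂̄Φ + ħ ∂̄) (L_f u)` on `V`, in each power of `ħ`. Here `v` and `w` are
  smooth functions with `v = ∂̄Φ u` and `w = ∂̄u` on `V`. -/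
  commutes : ∀ e, IsHolChart M e → ∀ (V : Set ℂ) (Φ : ℂ → ℝ), IsOpen V → V ⊆ e.target →
    ContDiffOn ℝ ∞ Φ V → (∀ z ∈ V, dz (dzbar fun w => (Φ w : ℂ)) z = G.g e z) →
    ∀ f u v w : SmoothFun M,
      (∀ z ∈ V, inChart e v z = dzbar (fun w => (Φ w : ℂ)) z * inChart e u z) →
      (∀ z ∈ V, inChart e w z = dzbar (inChart e u) z) →
      ∀ n, ∀ z ∈ V,
        inChart e (PowerSeries.coeff n
            (starProd C (PowerSeries.C f) (PowerSeries.C v + PowerSeries.X * PowerSeries.C w))) z =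
          dzbar (fun w => (Φ w : ℂ)) z * inChart e (PowerSeries.coeff n
              (starProd C (PowerSeries.C f) (PowerSeries.C u))) z
            + dzbar (inChart e (PowerSeries.coeff n
              (PowerSeries.X * starProd C (PowerSeries.C f) (PowerSeries.C u)))) z

end Manifold

/-! ### The closed formula -/

/-- The formal power series `2ħ / (2k + ħ k (k - 1) R)` in `ħ` (for `k ≥ 1` the denominator has the
invertible constant term `2k`). -/
def factor (R : ℂ) (k : ℕ) : ℂ⟦X⟧ :=
  PowerSeries.C 2 * PowerSeries.X *
    (PowerSeries.C (2 * (k : ℂ)) + PowerSeries.X * PowerSeries.C ((k : ℂ) * ((k : ℂ) - 1) * R))⁻¹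

/-- `T^n = (g_{1 1̄})^n ∏_{k=1}^n 2ħ / (2k + ħ k (k - 1) R)`. -/
def starCoeff (h R : ℂ) (n : ℕ) : ℂ⟦X⟧ :=
  PowerSeries.C (h ^ n) * ∏ k ∈ Finset.Icc 1 n, factor R k

end KahlerStar

end

noncomputable section

namespace KahlerStar

/-! ### Jets of an algebra with two commuting derivations -/

section Jets

variable {A : Type*} [CommRing A] [Algebra ℂ A]

/-! Write D = g^{1 1̄}∂ and D̄ = g^{1 1̄}∂̄, take a local Kähler potential Φ and put y = ∂̄Φ, x =
z̄. Since ∂y = g_{1 1̄} is invertible while ∂x = 0 and ∂̄x = 1, the pair (x, y) serves as formal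
coordinates at a point: to any finite order, every smooth germ agrees with a polynomial in x and y
(`exists_approx`).

One rigidity lemma, `mem_vanishing_of_commutes`, carries both uniqueness and associativity. Let T =
∑ ħ^n T_n, each T_n of finite order, commute with y + ħ∂̄ and kill antiholomorphic germs. By
induction on n, T_n commutes with y up to flat terms, so it is flat on all monomials y^i x^j, hence
on everything. Applied to the difference of the operators u ↦ f * u for two star products, this
gives uniqueness. Applied to L_f L_g - L_{f*g}, it gives associativity of the closed formula, once
every L_f is known to commute with y + ħ∂̄.

That commutation (`dbar_starTerm`) is the computation special to constant curvature. It uses [D, y]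
= 1, [∂̄, D] = -(g⁻¹∂̄g) D and D(g⁻¹∂̄g) = R. Moving ∂̄ across D^m therefore produces R m(m-1)/2 ·
D^{m-1}, and commutation reduces to the recursion m τ_m + ħ R m(m-1)/2 · τ_m = ħ τ_{m-1}, which the
product defining T^n solves.

For the global statement, ∇R = 0 makes R locally constant, R is real and independent of the chart,
and so is each g^m (D̄^m f)(D^m g); the local formulas therefore glue. Bump functions realise every
germ by a global smooth function, so that axioms stated for global functions can be tested on germs.
-/

/-- The elements whose derivatives of order less than `n` along `d` and `d'` vanish at `ev`. -/
def vanishing (d d' : Derivation ℂ A A) (ev : A →ₐ[ℂ] ℂ) : ℕ → Submodule ℂ A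
  | 0 => ⊤
  | n + 1 => LinearMap.ker ev.toLinearMap ⊓
      ((vanishing d d' ev n).comap (d : A →ₗ[ℂ] A) ⊓ (vanishing d d' ev n).comap (d' : A →ₗ[ℂ] A))

variable {d d' : Derivation ℂ A A} {ev : A →ₐ[ℂ] ℂ}

theorem mem_vanishing_zero (a : A) : a ∈ vanishing d d' ev 0 := Submodule.mem_top

theorem mem_vanishing_succ {n : ℕ} {a : A} :
    a ∈ vanishing d d' ev (n + 1) ↔
      ev a = 0 ∧ d a ∈ vanishing d d' ev n ∧ d' a ∈ vanishing d d' ev n := by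
  simp [vanishing]

theorem vanishing_succ_le (n : ℕ) : vanishing d d' ev (n + 1) ≤ vanishing d d' ev n := by
  induction n with
  | zero => exact fun a _ => mem_vanishing_zero a
  | succ n ih =>
    intro a ha
    rw [mem_vanishing_succ] at ha ⊢
    exact ⟨ha.1, ih ha.2.1, ih ha.2.2⟩

theorem vanishing_antitone : Antitone (vanishing d d' ev) :=
  antitone_nat_of_succ_le vanishing_succ_le

theorem mul_mem_vanishing {n : ℕ} (a : A) {b : A} (hb : b ∈ vanishing d d' ev n) :
    a * b ∈ vanishing d d' ev n := by
  induction n generalizing a b with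
  | zero => exact mem_vanishing_zero _
  | succ n ih =>
    have hb' := vanishing_succ_le n hb
    rw [mem_vanishing_succ] at hb ⊢
    refine ⟨by simp [hb.1], ?_, ?_⟩
    · rw [Derivation.leibniz, smul_eq_mul, smul_eq_mul, mul_comm b]
      exact add_mem (ih a hb.2.1) (ih _ hb')
    · rw [Derivation.leibniz, smul_eq_mul, smul_eq_mul, mul_comm b]
      exact add_mem (ih a hb.2.2) (ih _ hb')

/-- The germs `y` of `∂̄Φ` and `x` of `z̄`, together with the inverse `k` of `∂y`. -/
structure AdaptedCoordinates (d d' : Derivation ℂ A A) (x y k : A) : Prop where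
  comm : ∀ a, d (d' a) = d' (d a)
  mul_inv : d y * k = 1
  d_x : d x = 0
  dbar_x : d' x = 1

/-! ### Taylor polynomials in the coordinates ∂̄Φ and z̄, and rigidity of operators. -/

namespace AdaptedCoordinates

variable {x y k : A} (H : AdaptedCoordinates d d' x y k)
include H

/-- The derivation dual to `y`. -/
theorem dual_y_apply_y : (k • d) y = 1 := by
  rw [Derivation.smul_apply, smul_eq_mul, mul_comm, H.mul_inv]

theorem deriv_inv (δ : Derivation ℂ A A) : δ k = -(k * k) * δ (d y) := by
  have h := congrArg δ H.mul_inv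
  rw [Derivation.leibniz, Derivation.map_one_eq_zero, smul_eq_mul, smul_eq_mul] at h
  linear_combination k * h - δ k * H.mul_inv

/-- `k • d` and `d' - (d' y * k) • d` are the coordinate fields ∂/∂y and ∂/∂x of the coordinates (x,
y), so they commute. The computation uses only that `d` and `d'` commute and that `k` is the inverse
of `d y`. -/
theorem dual_comm (a : A) :
    (k • d) ((d' - (d' y * k) • d) a) = (d' - (d' y * k) • d) ((k • d) a) := by
  simp only [Derivation.smul_apply, Derivation.sub_apply, smul_eq_mul, map_sub, Derivation.leibniz,
    H.deriv_inv, H.comm]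
  ring

/-- `d` and `d'` are combinations of the dual fields with coefficients in the algebra, and
`vanishing` is closed under multiplication, so the order of vanishing may be measured with the dual
fields. -/
theorem mem_vanishing_succ_of_dual {n : ℕ} {a : A} (h0 : ev a = 0)
    (h1 : (k • d) a ∈ vanishing d d' ev n)
    (h2 : (d' - (d' y * k) • d) a ∈ vanishing d d' ev n) : a ∈ vanishing d d' ev (n + 1) := by
  rw [mem_vanishing_succ]
  refine ⟨h0, ?_, ?_⟩
  · have : d a = d y * (k • d) a := by
      rw [Derivation.smul_apply, smul_eq_mul, ← mul_assoc, H.mul_inv, one_mul]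
    rw [this]
    exact mul_mem_vanishing _ h1
  · have : d' a = (d' - (d' y * k) • d) a + d' y * (k • d) a := by
      simp only [Derivation.smul_apply, Derivation.sub_apply, smul_eq_mul]
      ring
    rw [this]
    exact add_mem h2 (mul_mem_vanishing _ h1)

theorem dual_x_pow (j : ℕ) : (d' - (d' y * k) • d) (x ^ (j + 1)) = ((j : ℂ) + 1) • x ^ j := by
  simp [Derivation.leibniz_pow, H.d_x, H.dbar_x, Algebra.smul_def]

theorem d_x_pow (j : ℕ) : d (x ^ j) = 0 := by
  simp [Derivation.leibniz_pow, H.d_x]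

/-- Integration in x of a polynomial in x alone. The primitive is again killed by ∂/∂y, so
subtracting it does not disturb an estimate already obtained on the y-derivative. -/
theorem exists_antideriv_x {q : A} (hq : q ∈ Submodule.span ℂ (Set.range fun j : ℕ => x ^ j)) :
    ∃ Q ∈ Submodule.span ℂ (Set.range fun j : ℕ => x ^ j),
      (d' - (d' y * k) • d) Q = q ∧ (k • d) Q = 0 := by
  induction hq using Submodule.span_induction with
  | mem q hq =>
    obtain ⟨j, rfl⟩ := hq
    have hj : (j : ℂ) + 1 ≠ 0 := Nat.cast_add_one_ne_zero j
    refine ⟨((j : ℂ) + 1)⁻¹ • x ^ (j + 1),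
      Submodule.smul_mem _ _ (Submodule.subset_span ⟨j + 1, rfl⟩), ?_, ?_⟩
    · rw [Derivation.map_smul, H.dual_x_pow, smul_smul, inv_mul_cancel₀ hj, one_smul]
    · rw [Derivation.map_smul, Derivation.smul_apply, H.d_x_pow]
      simp
  | zero => exact ⟨0, zero_mem _, by simp, by simp⟩
  | add q r _ _ hq hr =>
    obtain ⟨Q, hQ, hQ1, hQ2⟩ := hq
    obtain ⟨S, hS, hS1, hS2⟩ := hr
    exact ⟨Q + S, add_mem hQ hS, by rw [map_add, hQ1, hS1], by rw [map_add, hQ2, hS2, add_zero]⟩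
  | smul c q _ hq =>
    obtain ⟨Q, hQ, hQ1, hQ2⟩ := hq
    exact ⟨c • Q, Submodule.smul_mem _ _ hQ, by rw [Derivation.map_smul, hQ1],
      by rw [Derivation.map_smul, hQ2, smul_zero]⟩

theorem exists_antideriv_y {q : A}
    (hq : q ∈ Submodule.span ℂ (Set.range fun p : ℕ × ℕ => y ^ p.1 * x ^ p.2)) :
    ∃ Q ∈ Submodule.span ℂ (Set.range fun p : ℕ × ℕ => y ^ p.1 * x ^ p.2), (k • d) Q = q := by
  induction hq using Submodule.span_induction with
  | mem q hq =>
    obtain ⟨⟨i, j⟩, rfl⟩ := hq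
    have hi : (i : ℂ) + 1 ≠ 0 := Nat.cast_add_one_ne_zero i
    refine ⟨((i : ℂ) + 1)⁻¹ • (y ^ (i + 1) * x ^ j),
      Submodule.smul_mem _ _ (Submodule.subset_span ⟨(i + 1, j), rfl⟩), ?_⟩
    have h1 : (k • d) (y ^ (i + 1) * x ^ j) = ((i : ℂ) + 1) • (y ^ i * x ^ j) := by
      have hx : (k • d) (x ^ j) = 0 := by rw [Derivation.smul_apply, H.d_x_pow, smul_zero]
      rw [Derivation.leibniz, hx, Derivation.leibniz_pow, H.dual_y_apply_y]
      simp [Algebra.smul_def]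
      ring
    rw [Derivation.map_smul, h1, smul_smul, inv_mul_cancel₀ hi, one_smul]
  | zero => exact ⟨0, zero_mem _, by simp⟩
  | add q r _ _ hq hr =>
    obtain ⟨Q, hQ, hQ1⟩ := hq
    obtain ⟨S, hS, hS1⟩ := hr
    exact ⟨Q + S, add_mem hQ hS, by rw [map_add, hQ1, hS1]⟩
  | smul c q _ hq =>
    obtain ⟨Q, hQ, hQ1⟩ := hq
    exact ⟨c • Q, Submodule.smul_mem _ _ hQ, by rw [Derivation.map_smul, hQ1]⟩

/-- If the y-derivative is negligible, then a polynomial in x suffices: approximate the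
x-derivative, integrate, and adjust the constant. -/
theorem exists_approx_x (n : ℕ) (v : A) (hv : (k • d) v ∈ vanishing d d' ev n) :
    ∃ q ∈ Submodule.span ℂ (Set.range fun j : ℕ => x ^ j), v - q ∈ vanishing d d' ev (n + 1) := by
  have hone : (1 : A) ∈ Submodule.span ℂ (Set.range fun j : ℕ => x ^ j) :=
    Submodule.subset_span ⟨0, pow_zero x⟩
  induction n generalizing v with
  | zero =>
    refine ⟨ev v • 1, Submodule.smul_mem _ _ hone, ?_⟩
    rw [mem_vanishing_succ]
    exact ⟨by simp, mem_vanishing_zero _, mem_vanishing_zero _⟩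
  | succ n ih =>
    obtain ⟨q, hq, hvq⟩ := ih ((d' - (d' y * k) • d) v) (by
      -- The y-derivative of ∂v/∂x is the x-derivative of ∂v/∂y, so it is small to one order less,
      -- which is what the induction hypothesis asks.
      rw [H.dual_comm]
      rw [mem_vanishing_succ] at hv
      rw [Derivation.sub_apply, Derivation.smul_apply]
      exact sub_mem hv.2.2 (mul_mem_vanishing _ hv.2.1))
    obtain ⟨Q, hQ, hQ1, hQ2⟩ := H.exists_antideriv_x hq
    -- The added constant corrects the value at the point and leaves all derivatives unchanged.
    refine ⟨Q + ev (v - Q) • 1, add_mem hQ (Submodule.smul_mem _ _ hone), ?_⟩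
    apply H.mem_vanishing_succ_of_dual
    · simp
    · rw [map_sub, map_add, hQ2, Derivation.map_smul, Derivation.map_one_eq_zero, smul_zero,
        add_zero, sub_zero]
      exact hv
    · rw [map_sub, map_add, hQ1, Derivation.map_smul, Derivation.map_one_eq_zero, smul_zero,
        add_zero]
      exact hvq

/-- Every element agrees to any order with a polynomial in `x` and `y`. -/
theorem exists_approx (n : ℕ) (u : A) :
    ∃ q ∈ Submodule.span ℂ (Set.range fun p : ℕ × ℕ => y ^ p.1 * x ^ p.2),
      u - q ∈ vanishing d d' ev n := by
  induction n generalizing u with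
  | zero => exact ⟨0, zero_mem _, mem_vanishing_zero _⟩
  | succ n ih =>
    obtain ⟨q, hq, huq⟩ := ih ((k • d) u)
    obtain ⟨Q, hQ, hQ1⟩ := H.exists_antideriv_y hq
    -- Once the y-primitive `Q` is removed, the y-derivative of the remainder is negligible, so only
    -- a polynomial in x is missing.
    obtain ⟨r, hr, hur⟩ := H.exists_approx_x (ev := ev) n (u - Q) (by rwa [map_sub, hQ1])
    refine ⟨Q + r, add_mem hQ ?_, by rwa [← sub_sub]⟩
    refine Submodule.span_mono ?_ hr
    rintro _ ⟨j, rfl⟩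
    exact ⟨(0, j), by simp⟩

/-- An operator that commutes with y up to flat terms and kills the powers of x is flat on every y^i
x^j; finite order and polynomial approximation extend this to all arguments. The map `ρ` is there
because in the application `T` acts on global functions while its conditions are read on germs. -/
theorem mem_vanishing_of_commutes_potential {S : Type*} [AddCommGroup S] [Module ℂ S] (ρ : S →ₗ[ℂ] A)
    (hρ : Function.Surjective ρ) (T : S →ₗ[ℂ] A)
    (hy : ∀ u v, ρ v = y * ρ u → ∀ K, T v - y * T u ∈ vanishing d d' ev K)
    (hb : ∀ b, d (ρ b) = 0 → T b = 0)
    (hfin : ∃ N, ∀ K u, ρ u ∈ vanishing d d' ev (N + K) → T u ∈ vanishing d d' ev K)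
    (u : S) (K : ℕ) : T u ∈ vanishing d d' ev K := by
  have hmon (i j : ℕ) (u : S) (hu : ρ u = y ^ i * x ^ j) : T u ∈ vanishing d d' ev K := by
    induction i generalizing u with
    | zero =>
      rw [hb u (by rw [hu, pow_zero, one_mul, H.d_x_pow])]
      exact zero_mem _
    | succ i ih =>
      obtain ⟨v, hv⟩ := hρ (y ^ i * x ^ j)
      have h := hy v u (by rw [hu, hv, pow_succ]; ring) K
      rw [← sub_add_cancel (T u) (y * T v)]
      exact add_mem h (mul_mem_vanishing _ (ih v hv))
  obtain ⟨N, hN⟩ := hfin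
  have hpoly : Submodule.span ℂ (Set.range fun p : ℕ × ℕ => y ^ p.1 * x ^ p.2) ≤
      ((vanishing d d' ev K).comap T).map ρ := by
    rw [Submodule.span_le]
    rintro _ ⟨⟨i, j⟩, rfl⟩
    obtain ⟨v, hv⟩ := hρ (y ^ i * x ^ j)
    exact ⟨v, hmon i j v hv, hv⟩
  -- `T` loses at most `N` orders, so an approximation to order `N + K` leaves an error that
  -- vanishes to order `K` after applying `T`.
  obtain ⟨q, hq, huq⟩ := H.exists_approx (ev := ev) (N + K) (ρ u)
  obtain ⟨v, hv, rfl⟩ := hpoly hq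
  rw [← sub_add_cancel (T u) (T v), ← map_sub]
  exact add_mem (hN K _ (by rwa [map_sub])) hv

/-- A formal differential operator that commutes with `y + ħ d'` and vanishes on the kernel of `d`
is flat. -/
theorem mem_vanishing_of_commutes {S : Type*} [AddCommGroup S] [Module ℂ S] (ρ : S →ₗ[ℂ] A)
    (hρ : Function.Surjective ρ) (T : ℕ → S →ₗ[ℂ] A)
    (h0 : ∀ u v, ρ v = y * ρ u → T 0 v = y * T 0 u)
    (hs : ∀ n u v w, ρ v = y * ρ u → ρ w = d' (ρ u) →
      T (n + 1) v + T n w = y * T (n + 1) u + d' (T n u))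
    (hb : ∀ n b, d (ρ b) = 0 → T n b = 0)
    (hfin : ∀ n, ∃ N, ∀ K u, ρ u ∈ vanishing d d' ev (N + K) → T n u ∈ vanishing d d' ev K)
    (n : ℕ) (u : S) (K : ℕ) : T n u ∈ vanishing d d' ev K := by
  induction n generalizing u K with
  | zero =>
    exact H.mem_vanishing_of_commutes_potential ρ hρ (T 0) (fun u v h K => by simp [h0 u v h]) (hb 0) (hfin 0) u K
  | succ n ih =>
    refine H.mem_vanishing_of_commutes_potential ρ hρ (T (n + 1)) (fun u v h K => ?_) (hb _) (hfin _) u K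
    obtain ⟨w, hw⟩ := hρ (d' (ρ u))
    -- The failure of `T (n + 1)` to commute with y is the commutator of `d'` with `T n`. It is flat
    -- by induction, used one order higher because `d'` costs one order.
    have e : T (n + 1) v - y * T (n + 1) u = d' (T n u) - T n w := by
      linear_combination hs n u v w h hw
    rw [e]
    exact sub_mem (mem_vanishing_succ.1 (ih u (K + 1))).2.2 (ih w K)

end AdaptedCoordinates

end Jets

/-! ### Formal power series and their constant terms -/

section FormalExt

variable {A B : Type*} [CommRing A] [CommRing B]

theorem powerSeries_eq_C_add_X_mul (f : A⟦X⟧) :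
    ∃ (a : A) (g : A⟦X⟧), f = PowerSeries.C a + PowerSeries.X * g :=
  ⟨_, _, by rw [add_comm]; exact PowerSeries.eq_X_mul_shift_add_const f⟩

/-- A property of pairs of series that is additive and compatible with multiplication by `ħ` can be
checked on constants. -/
theorem formal_ext (L : A⟦X⟧ → B⟦X⟧) (I : Ideal B)
    (hadd : ∀ f g, L (f + g) = L f + L g)
    (hX : ∀ f, L (PowerSeries.X * f) = PowerSeries.X * L f)
    (hC : ∀ a n, PowerSeries.coeff n (L (PowerSeries.C a)) ∈ I) (f : A⟦X⟧) (n : ℕ) :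
    PowerSeries.coeff n (L f) ∈ I := by
  induction n generalizing f with
  | zero =>
    obtain ⟨a, g, rfl⟩ := powerSeries_eq_C_add_X_mul f
    rw [hadd, hX, map_add, PowerSeries.coeff_zero_X_mul, add_zero]
    exact hC a 0
  | succ n ih =>
    obtain ⟨a, g, rfl⟩ := powerSeries_eq_C_add_X_mul f
    rw [hadd, hX, map_add, PowerSeries.coeff_succ_X_mul]
    exact I.add_mem (hC a _) (ih g)

theorem formal_ext_eq (L L' : A⟦X⟧ → B⟦X⟧)
    (hadd : ∀ f g, L (f + g) = L f + L g)
    (hX : ∀ f, L (PowerSeries.X * f) = PowerSeries.X * L f)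
    (hadd' : ∀ f g, L' (f + g) = L' f + L' g)
    (hX' : ∀ f, L' (PowerSeries.X * f) = PowerSeries.X * L' f)
    (hC : ∀ a, L (PowerSeries.C a) = L' (PowerSeries.C a)) (f : A⟦X⟧) : L f = L' f := by
  ext n
  rw [← sub_eq_zero, ← map_sub, ← Ideal.mem_bot]
  refine formal_ext (fun f => L f - L' f) ⊥ (fun f g => ?_) (fun f => ?_) (fun a n => ?_) f n
  · rw [hadd, hadd']; ring
  · rw [hX, hX']; ring
  · simp [hC]

end FormalExt

/-! ### Products of formal power series defined by a sequence of bilinear maps -/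

section FormalProduct

variable {A : Type*} [CommRing A] [Algebra ℂ A]

/-- The `ħ`-bilinear extension of `∑ n, ħ ^ n * c n`. -/
def formalProd (c : ℕ → A →ₗ[ℂ] A →ₗ[ℂ] A) (f g : A⟦X⟧) : A⟦X⟧ :=
  PowerSeries.mk fun n =>
    ∑ x ∈ Finset.HasAntidiagonal.antidiagonal n,
      ∑ y ∈ Finset.HasAntidiagonal.antidiagonal x.2,
        c x.1 (PowerSeries.coeff y.1 f) (PowerSeries.coeff y.2 g)

variable (c : ℕ → A →ₗ[ℂ] A →ₗ[ℂ] A)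

theorem coeff_formalProd (n : ℕ) (f g : A⟦X⟧) :
    PowerSeries.coeff n (formalProd c f g) =
      ∑ x ∈ Finset.HasAntidiagonal.antidiagonal n,
        ∑ y ∈ Finset.HasAntidiagonal.antidiagonal x.2,
          c x.1 (PowerSeries.coeff y.1 f) (PowerSeries.coeff y.2 g) :=
  PowerSeries.coeff_mk _ _

theorem formalProd_add (f g g' : A⟦X⟧) :
    formalProd c f (g + g') = formalProd c f g + formalProd c f g' := by
  ext n
  simp [coeff_formalProd, Finset.sum_add_distrib]

theorem add_formalProd (f f' g : A⟦X⟧) :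
    formalProd c (f + f') g = formalProd c f g + formalProd c f' g := by
  ext n
  simp [coeff_formalProd, Finset.sum_add_distrib]

theorem formalProd_smul (a : ℂ) (f g : A⟦X⟧) :
    formalProd c f (a • g) = a • formalProd c f g := by
  ext n
  simp [coeff_formalProd, Finset.smul_sum]

theorem formalProd_X_mul (f g : A⟦X⟧) :
    formalProd c f (PowerSeries.X * g) = PowerSeries.X * formalProd c f g := by
  ext n
  cases n with
  | zero => simp [coeff_formalProd]
  | succ n =>
    rw [PowerSeries.coeff_succ_X_mul, coeff_formalProd, coeff_formalProd,
      Finset.Nat.antidiagonal_succ']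
    simp only [Finset.sum_cons, Finset.sum_map]
    simp [Finset.Nat.antidiagonal_succ', PowerSeries.coeff_succ_X_mul]

theorem X_mul_formalProd (f g : A⟦X⟧) :
    formalProd c (PowerSeries.X * f) g = PowerSeries.X * formalProd c f g := by
  ext n
  cases n with
  | zero => simp [coeff_formalProd]
  | succ n =>
    rw [PowerSeries.coeff_succ_X_mul, coeff_formalProd, coeff_formalProd,
      Finset.Nat.antidiagonal_succ']
    simp only [Finset.sum_cons, Finset.sum_map]
    simp [Finset.Nat.antidiagonal_succ, PowerSeries.coeff_succ_X_mul]

theorem coeff_formalProd_C_C (n : ℕ) (f g : A) :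
    PowerSeries.coeff n (formalProd c (PowerSeries.C f) (PowerSeries.C g)) = c n f g := by
  rw [coeff_formalProd, Finset.sum_eq_single (n, 0)]
  · simp
  · rintro ⟨i, j⟩ hij hne
    refine Finset.sum_eq_zero ?_
    rintro ⟨a, b⟩ hab
    rw [Finset.HasAntidiagonal.mem_antidiagonal] at hij hab
    dsimp only at hij hab
    simp only [PowerSeries.coeff_C]
    have : a ≠ 0 ∨ b ≠ 0 := by
      by_contra! h
      exact hne (by ext <;> simp <;> omega)
    rcases this with h | h <;> simp [h]
  · simp

theorem map_formalProd {B : Type*} [CommRing B] [Algebra ℂ B] (ρ : A →ₐ[ℂ] B)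
    (c' : ℕ → B →ₗ[ℂ] B →ₗ[ℂ] B) (h : ∀ n f g, ρ (c n f g) = c' n (ρ f) (ρ g)) (f g : A⟦X⟧) :
    PowerSeries.map (ρ : A →+* B) (formalProd c f g) =
      formalProd c' (PowerSeries.map (ρ : A →+* B) f) (PowerSeries.map (ρ : A →+* B) g) := by
  ext n
  simp [coeff_formalProd, h]

end FormalProduct

/-! ### The coefficients of the closed formula -/

/-- The coefficient of `ħ ^ n` in `∏_{k=1}^m 2ħ / (2k + ħ k (k - 1) R)`. -/
def tau (R : ℂ) (m n : ℕ) : ℂ :=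
  PowerSeries.coeff n (∏ k ∈ Finset.Icc 1 m, factor R k)

theorem tau_zero_left (R : ℂ) (n : ℕ) : tau R 0 n = if n = 0 then 1 else 0 := by
  simp [tau, PowerSeries.coeff_one]

theorem factor_mul (R : ℂ) {k : ℕ} (hk : k ≠ 0) :
    factor R k * (PowerSeries.C (2 * (k : ℂ)) +
      PowerSeries.X * PowerSeries.C ((k : ℂ) * ((k : ℂ) - 1) * R)) =
        PowerSeries.C 2 * PowerSeries.X := by
  rw [factor, mul_assoc, PowerSeries.inv_mul_cancel, mul_one]
  simpa using hk

theorem prod_factor_succ (R : ℂ) (m : ℕ) :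
    ∏ k ∈ Finset.Icc 1 (m + 1), factor R k = (∏ k ∈ Finset.Icc 1 m, factor R k) * factor R (m + 1) :=
  Finset.prod_Icc_succ_top (by omega) _

theorem tau_succ_zero (R : ℂ) (m : ℕ) : tau R (m + 1) 0 = 0 := by
  rw [tau, prod_factor_succ]
  simp [factor]

/-- The coefficient of ħ^(n+1) after clearing the denominator of the last factor of the product.
This is the only property of that factor that the commutation with y + ħ∂̄ needs. -/
theorem tau_recursion (R : ℂ) (m n : ℕ) :
    ((m : ℂ) + 1) * tau R (m + 1) (n + 1) + R * ((m : ℂ) + 1) * m / 2 * tau R (m + 1) n =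
      tau R m n := by
  have h := congrArg (PowerSeries.coeff (n + 1))
    (congrArg (fun s => (∏ k ∈ Finset.Icc 1 m, factor R k) * s) (factor_mul R (Nat.succ_ne_zero m)))
  simp only [← mul_assoc] at h
  rw [← prod_factor_succ, mul_add, map_add, PowerSeries.coeff_mul_C,
    ← mul_assoc _ PowerSeries.X, PowerSeries.coeff_mul_C, PowerSeries.coeff_succ_mul_X, PowerSeries.coeff_succ_mul_X,
    PowerSeries.coeff_mul_C] at h
  change tau R (m + 1) (n + 1) * _ + tau R (m + 1) n * _ = tau R m n * _ at h
  push_cast at h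
  linear_combination h / 2

/-- Each factor is divisible by ħ, so the product of m of them starts at ħ^m. Hence every
ħ-coefficient of the closed formula is a finite sum. -/
theorem tau_eq_zero (R : ℂ) {m n : ℕ} (h : n < m) : tau R m n = 0 := by
  induction n generalizing m with
  | zero =>
    obtain ⟨m, rfl⟩ := Nat.exists_eq_succ_of_ne_zero h.ne'
    exact tau_succ_zero R m
  | succ n ih =>
    obtain ⟨m, rfl⟩ := Nat.exists_eq_succ_of_ne_zero (Nat.ne_zero_of_lt h)
    have h1 := tau_recursion R m n
    rw [ih (by omega), ih (by omega), mul_zero, add_zero] at h1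
    exact (mul_eq_zero.1 h1).resolve_left (Nat.cast_add_one_ne_zero m)

theorem tau_one_one (R : ℂ) : tau R 1 1 = 1 := by
  simpa [tau_zero_left] using tau_recursion R 0 0

/-! ### The star product in an algebra with two commuting derivations -/

section LocalStar

variable {A : Type*} [CommRing A] [Algebra ℂ A]

/-- The `n`-th bidifferential operator of the closed formula, for a metric `h` with inverse `k`. -/
def starTerm (d d' : Derivation ℂ A A) (h k : A) (R : ℂ) (n : ℕ) : A →ₗ[ℂ] A →ₗ[ℂ] A :=
  ∑ m ∈ Finset.range (n + 1), tau R m n •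
    ((LinearMap.mul ℂ A).compl₁₂
      (LinearMap.mulLeft ℂ (h ^ m) ∘ₗ (((k • d' : Derivation ℂ A A) : A →ₗ[ℂ] A) ^ m))
      (((k • d : Derivation ℂ A A) : A →ₗ[ℂ] A) ^ m))

variable {d d' : Derivation ℂ A A} {h k : A} {R : ℂ}

theorem starTerm_apply (n : ℕ) (f g : A) :
    starTerm d d' h k R n f g = ∑ m ∈ Finset.range (n + 1), tau R m n •
      (h ^ m * (k • d')^[m] f * (k • d)^[m] g) := by
  simp [starTerm, LinearMap.sum_apply, Module.End.pow_apply, LinearMap.compl₁₂_apply]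

theorem starTerm_apply_of_le {n N : ℕ} (hN : n + 1 ≤ N) (f g : A) :
    starTerm d d' h k R n f g = ∑ m ∈ Finset.range N, tau R m n •
      (h ^ m * (k • d')^[m] f * (k • d)^[m] g) := by
  rw [starTerm_apply]
  refine Finset.sum_subset (Finset.range_subset_range.2 hN) fun m _ hm => ?_
  rw [tau_eq_zero R (by simpa using hm), zero_smul]

theorem iterate_derivation_mul_const (δ : Derivation ℂ A A) (m : ℕ) (f : A) {b : A} (hb : δ b = 0) :
    δ^[m] (f * b) = δ^[m] f * b := by
  induction m generalizing f with
  | zero => rfl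
  | succ m ih =>
    rw [Function.iterate_succ_apply, Function.iterate_succ_apply, Derivation.leibniz, hb, smul_zero,
      zero_add, smul_eq_mul, mul_comm, ih]

theorem iterate_derivation_const (δ : Derivation ℂ A A) (m : ℕ) {b : A} (hb : δ b = 0) :
    δ^[m + 1] b = 0 := by
  rw [Function.iterate_succ_apply, hb]
  exact iterate_map_zero δ m

theorem starTerm_const (n : ℕ) (f : A) {b : A} (hb : d b = 0) :
    starTerm d d' h k R n f b = if n = 0 then f * b else 0 := by
  rw [starTerm_apply, Finset.sum_range_succ', Finset.sum_eq_zero]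
  · rw [tau_zero_left]
    split_ifs <;> simp
  · intro m _
    rw [iterate_derivation_const (k • d) m (by simp [hb]), mul_zero, smul_zero]

theorem const_starTerm (n : ℕ) {a : A} (ha : d' a = 0) (g : A) :
    starTerm d d' h k R n a g = if n = 0 then a * g else 0 := by
  rw [starTerm_apply, Finset.sum_range_succ', Finset.sum_eq_zero]
  · rw [tau_zero_left]
    split_ifs <;> simp
  · intro m _
    rw [iterate_derivation_const (k • d') m (by simp [ha]), mul_zero, zero_mul, smul_zero]

/-- Elements killed by `d` are scalars for every power of D. This is what makes the associator
vanish on antiholomorphic arguments. -/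
theorem starTerm_mul_const (n : ℕ) (f g : A) {b : A} (hb : d b = 0) :
    starTerm d d' h k R n f (g * b) = starTerm d d' h k R n f g * b := by
  rw [starTerm_apply, starTerm_apply, Finset.sum_mul]
  refine Finset.sum_congr rfl fun m _ => ?_
  rw [iterate_derivation_mul_const (k • d) m g (by simp [hb]), smul_mul_assoc, mul_assoc, mul_assoc,
    mul_assoc]

theorem iterate_mem_vanishing {ev : A →ₐ[ℂ] ℂ} (m K : ℕ) {u : A}
    (hu : u ∈ vanishing d d' ev (m + K)) : (k • d)^[m] u ∈ vanishing d d' ev K := by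
  induction m generalizing u with
  | zero => simpa using hu
  | succ m ih =>
    rw [Function.iterate_succ_apply]
    apply ih
    rw [show m + 1 + K = m + K + 1 by ring, mem_vanishing_succ] at hu
    exact mul_mem_vanishing _ hu.2.1

theorem starTerm_mem_vanishing {ev : A →ₐ[ℂ] ℂ} (n K : ℕ) (f : A) {u : A}
    (hu : u ∈ vanishing d d' ev (n + K)) : starTerm d d' h k R n f u ∈ vanishing d d' ev K := by
  rw [starTerm_apply]
  refine Submodule.sum_mem _ fun m hm => Submodule.smul_mem _ _ (mul_mem_vanishing _ ?_)
  refine iterate_mem_vanishing m K (vanishing_antitone ?_ hu)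
  have := Finset.mem_range.1 hm
  omega

/-- `h` is a metric with inverse `k` and curvature component `R`. -/
structure ConstantCurvature (d d' : Derivation ℂ A A) (h k : A) (R : ℂ) : Prop where
  comm : ∀ a, d (d' a) = d' (d a)
  mul_inv : h * k = 1
  curvature : d (k * d' h) = R • h

/-! ### Commutation of left star multiplication with ∂̄Φ + ħ∂̄ in constant curvature. -/

namespace ConstantCurvature

variable (H : ConstantCurvature d d' h k R)
include H

theorem deriv_inv (δ : Derivation ℂ A A) : δ k = -(k * k) * δ h := by
  have h := congrArg δ H.mul_inv
  rw [Derivation.leibniz, Derivation.map_one_eq_zero, smul_eq_mul, smul_eq_mul] at h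
  linear_combination k * h - δ k * H.mul_inv

/-- The Heisenberg relation: `D y = 1` for `D = k • d`, so [D, y] = 1 and [D^(m+1), y] = (m+1) D^m.
-/
theorem iterate_mul_potential {y : A} (hy : d y = h) (m : ℕ)
    (u : A) :
    (k • d)^[m + 1] (y * u) = y * (k • d)^[m + 1] u + ((m : A) + 1) * (k • d)^[m] u := by
  have hDy : k * d y = 1 := by rw [hy, mul_comm, H.mul_inv]
  induction m with
  | zero =>
    simp only [zero_add, Function.iterate_one, Function.iterate_zero, id, Derivation.smul_apply,
      Derivation.leibniz, smul_eq_mul]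
    push_cast
    linear_combination u * hDy
  | succ m ih =>
    rw [Function.iterate_succ_apply', ih, Function.iterate_succ_apply' _ (m + 1),
      Function.iterate_succ_apply' _ m]
    simp only [Derivation.smul_apply, Derivation.leibniz, smul_eq_mul, map_add,
      Derivation.map_natCast, Derivation.map_one_eq_zero]
    push_cast
    linear_combination (k * d ((k • d)^[m] u)) * hDy

/-- From [d', D] = -(k d'h) D, each D that is passed yields one factor k d'h; the later D's may
differentiate that factor, and D(k d'h) = R. Counting pairs of D's gives the coefficient R(m+1)m/2.
-/
theorem dbar_iterate (m : ℕ) (u : A) :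
    d' ((k • d)^[m + 1] u) = (k • d)^[m + 1] (d' u)
      - ((m : A) + 1) * (k * d' h) * (k • d)^[m + 1] u
      - algebraMap ℂ A (R * ((m : ℂ) + 1) * m / 2) * (k • d)^[m] u := by
  have hstep (a : A) : d' ((k • d) a) = (k • d) (d' a) - (k * d' h) * (k • d) a := by
    simp only [Derivation.smul_apply, Derivation.leibniz, smul_eq_mul, H.deriv_inv, H.comm]
    ring
  have hcurv : k * d (k * d' h) = algebraMap ℂ A R := by
    rw [H.curvature, Algebra.smul_def]
    linear_combination algebraMap ℂ A R * H.mul_inv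
  induction m with
  | zero =>
    simp only [zero_add, Function.iterate_one, Function.iterate_zero, id, hstep]
    simp
  | succ m ih =>
    -- The increment of the triangular number: differentiating the accumulated (m+1) k d'h adds
    -- R(m+1).
    have e : algebraMap ℂ A (R * (((m + 1 : ℕ) : ℂ) + 1) * (m + 1 : ℕ) / 2) =
        algebraMap ℂ A (R * ((m : ℂ) + 1) * m / 2) + algebraMap ℂ A R * ((m : A) + 1) := by
      rw [← map_natCast (algebraMap ℂ A) m, ← map_one (algebraMap ℂ A), ← map_add, ← map_mul,
        ← map_add]
      congr 1
      push_cast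
      ring
    rw [Function.iterate_succ_apply', hstep, ih, e, Function.iterate_succ_apply' _ (m + 1) (d' u)]
    have hw : (k • d) ((k • d)^[m] u) = (k • d)^[m + 1] u :=
      (Function.iterate_succ_apply' _ m u).symm
    have hβ : (k • d) (k * d' h) = algebraMap ℂ A R := hcurv
    -- With the iterates and k d'h made opaque, only Leibniz, `hβ` and `hw` are left to use.
    generalize (k • d)^[m + 1] (d' u) = U
    generalize (k • d)^[m + 1] u = w at *
    generalize (k • d)^[m] u = v at *
    generalize k * d' h = β at *
    generalize R * ((m : ℂ) + 1) * m / 2 = s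
    generalize k • d = D at *
    simp only [map_sub, Derivation.leibniz, smul_eq_mul, map_add, Derivation.map_natCast,
      Derivation.map_one_eq_zero, Derivation.map_algebraMap, hβ, hw]
    push_cast
    ring

theorem dbar_pow_metric (m : ℕ) : d' (h ^ m) = (m : A) * (k * d' h) * h ^ m := by
  rw [Derivation.leibniz_pow]
  cases m with
  | zero => simp
  | succ m =>
    simp only [Nat.add_sub_cancel, nsmul_eq_mul, smul_eq_mul, pow_succ]
    linear_combination -((m + 1 : ℕ) : A) * h ^ m * d' h * H.mul_inv

/-- The derivative of h^m cancels the k d'h term of `dbar_iterate`. What remains pairs [D^m, y] and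
the curvature term with the derivative falling on D̄^(m-1) f in the preceding summand, and the
recursion for `tau` makes these cancel. -/
theorem dbar_starTerm (n : ℕ) {y : A} (hy : d y = h) (f u : A) :
    starTerm d d' h k R (n + 1) f (y * u) + starTerm d d' h k R n f (d' u) =
      y * starTerm d d' h k R (n + 1) f u + d' (starTerm d d' h k R n f u) := by
  have hcast (m : ℕ) : algebraMap ℂ A (((m : ℂ) + 1) * tau R (m + 1) (n + 1)) =
      algebraMap ℂ A (tau R m n) -
        algebraMap ℂ A (R * ((m : ℂ) + 1) * m / 2) * algebraMap ℂ A (tau R (m + 1) n) := by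
    rw [← tau_recursion R m n, ← map_mul, ← map_sub]
    ring_nf
  have hcast' (m : ℕ) : algebraMap ℂ A (((m : ℂ) + 1) * tau R (m + 1) (n + 1)) =
      ((m : A) + 1) * algebraMap ℂ A (tau R (m + 1) (n + 1)) := by
    simp
  have hk' (a : A) : d' a = h * (k • d') a := by
    rw [Derivation.smul_apply, smul_eq_mul]
    linear_combination -d' a * H.mul_inv
  rw [starTerm_apply_of_le (n := n + 1) le_rfl, starTerm_apply_of_le (n := n + 1) le_rfl,
    starTerm_apply_of_le (n := n) (N := n + 1 + 1) (by omega),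
    starTerm_apply_of_le (n := n) (N := n + 1 + 1) (by omega), map_sum, Finset.mul_sum,
    ← Finset.sum_add_distrib, ← Finset.sum_add_distrib, ← sub_eq_zero, ← Finset.sum_sub_distrib]
  -- Summand m contributes F(m-1) - F(m), so the sum telescopes. Its last boundary term carries `tau
  -- R (n + 1) n`, which is zero.
  set F : ℕ → A := fun m => tau R m n • (h ^ (m + 1) * (k • d')^[m + 1] f * (k • d)^[m] u) with hF
  have key (N : ℕ) : ∑ m ∈ Finset.range (N + 1),
      (tau R m (n + 1) • (h ^ m * (k • d')^[m] f * (k • d)^[m] (y * u)) +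
          tau R m n • (h ^ m * (k • d')^[m] f * (k • d)^[m] (d' u)) -
        (y * tau R m (n + 1) • (h ^ m * (k • d')^[m] f * (k • d)^[m] u) +
          d' (tau R m n • (h ^ m * (k • d')^[m] f * (k • d)^[m] u)))) = -F N := by
    induction N with
    | zero =>
      simp only [zero_add, Finset.sum_range_one, Function.iterate_zero, id, pow_zero, one_mul,
        Derivation.map_smul, hF, Function.iterate_one, pow_one]
      simp only [Derivation.leibniz, smul_eq_mul, hk' f, Algebra.smul_def]
      ring
    | succ m ih =>
      rw [Finset.sum_range_succ, ih]
      simp only [Derivation.map_smul, hF]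
      rw [H.iterate_mul_potential hy, Derivation.leibniz, Derivation.leibniz, H.dbar_pow_metric,
        hk' ((k • d')^[m + 1] f), ← Function.iterate_succ_apply' (k • d' : Derivation ℂ A A) (m + 1) f,
        H.dbar_iterate]
      simp only [smul_eq_mul, Algebra.smul_def]
      have h1 := hcast m
      rw [hcast'] at h1
      push_cast
      linear_combination (h ^ (m + 1) * (k • d')^[m + 1] f * (k • d)^[m] u) * h1
  rw [key]
  simp [hF, tau_eq_zero R (Nat.lt_succ_self n)]

end ConstantCurvature

/-- The operator `y + ħ d'` on formal power series. -/
def potentialOp (d' : Derivation ℂ A A) (y : A) : A⟦X⟧ →+ A⟦X⟧ where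
  toFun u := PowerSeries.C y * u + PowerSeries.X * PowerSeries.mk fun n => d' (PowerSeries.coeff n u)
  map_zero' := by
    ext n
    cases n <;> simp [PowerSeries.coeff_succ_X_mul]
  map_add' u v := by
    ext n
    cases n
    · simp [mul_add]
    · simp [mul_add, PowerSeries.coeff_succ_X_mul]
      ring

theorem coeff_zero_potentialOp (y : A) (u : A⟦X⟧) :
    PowerSeries.coeff 0 (potentialOp d' y u) = y * PowerSeries.coeff 0 u := by
  simp [potentialOp]

theorem coeff_succ_potentialOp (y : A) (u : A⟦X⟧) (n : ℕ) :
    PowerSeries.coeff (n + 1) (potentialOp d' y u) =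
      y * PowerSeries.coeff (n + 1) u + d' (PowerSeries.coeff n u) := by
  simp [potentialOp, PowerSeries.coeff_succ_X_mul]

theorem potentialOp_X_mul (y : A) (u : A⟦X⟧) :
    potentialOp d' y (PowerSeries.X * u) = PowerSeries.X * potentialOp d' y u := by
  ext n
  cases n with
  | zero => simp [coeff_zero_potentialOp]
  | succ n =>
    rw [coeff_succ_potentialOp, PowerSeries.coeff_succ_X_mul, PowerSeries.coeff_succ_X_mul]
    cases n with
    | zero => simp [coeff_zero_potentialOp]
    | succ n => rw [PowerSeries.coeff_succ_X_mul, coeff_succ_potentialOp]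

theorem potentialOp_C (y u : A) :
    potentialOp d' y (PowerSeries.C u) =
      PowerSeries.C (y * u) + PowerSeries.X * PowerSeries.C (d' u) := by
  ext n
  rcases n with _ | n
  · simp [coeff_zero_potentialOp]
  · rw [coeff_succ_potentialOp, map_add, PowerSeries.coeff_succ_X_mul]
    simp only [PowerSeries.coeff_C]
    rcases n with _ | n <;> simp

/-- Both sides are additive and ħ-linear in each argument, so constants suffice. There the
coefficient of ħ^(n+1) is `dbar_starTerm` and that of ħ^0 is commutativity of the ordinary product.
-/
theorem ConstantCurvature.formalProd_potentialOp (H : ConstantCurvature d d' h k R) {y : A}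
    (hy : d y = h) (f u : A⟦X⟧) :
    formalProd (starTerm d d' h k R) f (potentialOp d' y u) =
      potentialOp d' y (formalProd (starTerm d d' h k R) f u) := by
  refine formal_ext_eq (fun u => formalProd (starTerm d d' h k R) f (potentialOp d' y u))
    (fun u => potentialOp d' y (formalProd (starTerm d d' h k R) f u))
    (fun u v => by rw [map_add, formalProd_add])
    (fun u => by rw [potentialOp_X_mul, formalProd_X_mul])
    (fun u v => by rw [formalProd_add, map_add])
    (fun u => by rw [formalProd_X_mul, potentialOp_X_mul]) (fun u => ?_) u
  refine formal_ext_eq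
    (fun f => formalProd (starTerm d d' h k R) f (potentialOp d' y (PowerSeries.C u)))
    (fun f => potentialOp d' y (formalProd (starTerm d d' h k R) f (PowerSeries.C u)))
    (fun u v => by rw [add_formalProd])
    (fun u => by rw [X_mul_formalProd])
    (fun u v => by rw [add_formalProd, map_add])
    (fun u => by rw [X_mul_formalProd, potentialOp_X_mul]) (fun f => ?_) f
  ext n
  rw [potentialOp_C, formalProd_add, formalProd_X_mul, map_add, coeff_formalProd_C_C]
  rcases n with _ | n
  · rw [coeff_zero_potentialOp, coeff_formalProd_C_C, PowerSeries.coeff_zero_X_mul]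
    simp [starTerm_apply, tau_zero_left]
    ring
  · rw [PowerSeries.coeff_succ_X_mul, coeff_succ_potentialOp, coeff_formalProd_C_C,
      coeff_formalProd_C_C, coeff_formalProd_C_C]
    exact H.dbar_starTerm n hy f u

theorem formalProd_const (f : A⟦X⟧) {b : A} (hb : d b = 0) :
    formalProd (starTerm d d' h k R) f (PowerSeries.C b) = f * PowerSeries.C b := by
  refine formal_ext_eq (fun f => formalProd (starTerm d d' h k R) f (PowerSeries.C b))
    (fun f => f * PowerSeries.C b)
    (fun u v => by rw [add_formalProd]) (fun u => by rw [X_mul_formalProd])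
    (fun u v => add_mul _ _ _) (fun u => mul_assoc _ _ _) (fun f => ?_) f
  ext n
  rw [coeff_formalProd_C_C, starTerm_const n f hb, ← map_mul, PowerSeries.coeff_C]

theorem const_formalProd {a : A} (ha : d' a = 0) (g : A⟦X⟧) :
    formalProd (starTerm d d' h k R) (PowerSeries.C a) g = PowerSeries.C a * g := by
  refine formal_ext_eq (fun g => formalProd (starTerm d d' h k R) (PowerSeries.C a) g)
    (fun g => PowerSeries.C a * g)
    (fun u v => by rw [formalProd_add]) (fun u => by rw [formalProd_X_mul])
    (fun u v => mul_add _ _ _) (fun u => mul_left_comm _ _ _) (fun g => ?_) g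
  ext n
  rw [coeff_formalProd_C_C, const_starTerm n ha g, ← map_mul, PowerSeries.coeff_C]

theorem formalProd_mul_const (f g : A⟦X⟧) {b : A} (hb : d b = 0) :
    formalProd (starTerm d d' h k R) f (g * PowerSeries.C b) =
      formalProd (starTerm d d' h k R) f g * PowerSeries.C b := by
  ext n
  simp [coeff_formalProd, Finset.sum_mul, starTerm_mul_const _ _ _ hb]

theorem coeff_formalProd_mem_vanishing {ev : A →ₐ[ℂ] ℂ} {n K : ℕ} (f : A⟦X⟧) {u : A⟦X⟧}
    (hu : ∀ j ≤ n, PowerSeries.coeff j u ∈ vanishing d d' ev (n + K)) :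
    ∀ j ≤ n, PowerSeries.coeff j (formalProd (starTerm d d' h k R) f u) ∈
      vanishing d d' ev K := by
  intro j hj
  rw [coeff_formalProd]
  refine Submodule.sum_mem _ fun p hp => Submodule.sum_mem _ fun q hq => ?_
  rw [Finset.HasAntidiagonal.mem_antidiagonal] at hp hq
  exact starTerm_mem_vanishing _ _ _ (vanishing_antitone (by omega) (hu q.2 (by omega)))

/-- The associator of the star product is flat. -/
theorem ConstantCurvature.associator_mem_vanishing (H : ConstantCurvature d d' h k R)
    {ev : A →ₐ[ℂ] ℂ} {x y : A} (hy : d y = h) (hx : d x = 0) (hx' : d' x = 1) (f g u : A⟦X⟧)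
    (n K : ℕ) :
    PowerSeries.coeff n
      (formalProd (starTerm d d' h k R) f (formalProd (starTerm d d' h k R) g u) -
        formalProd (starTerm d d' h k R) (formalProd (starTerm d d' h k R) f g) u) ∈
      vanishing d d' ev K := by
  have HA : AdaptedCoordinates d d' x y k := ⟨H.comm, by rw [hy, H.mul_inv], hx, hx'⟩
  set c := starTerm d d' h k R
  let L : A⟦X⟧ → A⟦X⟧ := fun u => formalProd c f (formalProd c g u) - formalProd c (formalProd c f g) u
  have hadd (u v) : L (u + v) = L u + L v := by
    simp only [L, formalProd_add]
    ring
  have hsmul (a : ℂ) (u) : L (a • u) = a • L u := by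
    simp only [L, formalProd_smul, smul_sub]
  have hX (u) : L (PowerSeries.X * u) = PowerSeries.X * L u := by
    simp only [L, formalProd_X_mul]
    ring
  -- Left multiplication by any series commutes with y + ħd', in particular by f, by g and by the
  -- product of f and g.
  have hP (u) : L (potentialOp d' y u) = potentialOp d' y (L u) := by
    simp only [L, map_sub]
    rw [H.formalProd_potentialOp hy, H.formalProd_potentialOp hy, H.formalProd_potentialOp hy]
  let T : ℕ → A →ₗ[ℂ] A := fun n =>
    { toFun := fun u => PowerSeries.coeff n (L (PowerSeries.C u))
      map_add' := fun u v => by rw [map_add, hadd, map_add]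
      map_smul' := fun a u => by
        have : PowerSeries.C (a • u) = a • PowerSeries.C u := by
          ext n
          simp [PowerSeries.coeff_C]
        rw [this, hsmul]
        simp }
  -- Vanishing to order `K` as an ideal, so that `formal_ext` reduces the claim to a constant `u`.
  let I : Ideal A :=
    { carrier := vanishing d d' ev K
      add_mem' := add_mem
      zero_mem' := zero_mem _
      smul_mem' := fun a b hb => mul_mem_vanishing a hb }
  refine formal_ext L I hadd hX (fun u n => ?_) u n
  change T n u ∈ vanishing d d' ev K
  have hcomm (u : A) : L (PowerSeries.C (y * u)) + PowerSeries.X * L (PowerSeries.C (d' u)) =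
      potentialOp d' y (L (PowerSeries.C u)) := by
    rw [← hP, potentialOp_C, hadd, hX]
  refine HA.mem_vanishing_of_commutes LinearMap.id Function.surjective_id T ?_ ?_ ?_ ?_ n u K
  · rintro u v h
    have := congrArg (PowerSeries.coeff 0) (hcomm u)
    rw [map_add, PowerSeries.coeff_zero_X_mul, add_zero, coeff_zero_potentialOp] at this
    rw [LinearMap.id_apply, LinearMap.id_apply] at h
    rw [h]
    exact this
  · rintro n u v w h h'
    have := congrArg (PowerSeries.coeff (n + 1)) (hcomm u)
    rw [map_add, PowerSeries.coeff_succ_X_mul, coeff_succ_potentialOp] at this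
    rw [LinearMap.id_apply, LinearMap.id_apply] at h h'
    rw [h, h']
    exact this
  · intro n b hb
    rw [LinearMap.id_apply] at hb
    change PowerSeries.coeff n (L (PowerSeries.C b)) = 0
    simp only [L]
    -- For b with d b = 0, both f * (g * b) and (f * g) * b equal (f * g) b.
    rw [formalProd_const _ hb, formalProd_const _ hb, formalProd_mul_const _ _ hb, sub_self, map_zero]
  · intro n
    -- Two successive star multiplications, each costing at most n orders in coefficients up to ħ^n.
    refine ⟨n + n, fun K u hu => ?_⟩
    have hC (K : ℕ) (hu : u ∈ vanishing d d' ev K) (j : ℕ) :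
        PowerSeries.coeff j (PowerSeries.C u) ∈ vanishing d d' ev K := by
      rw [PowerSeries.coeff_C]
      split_ifs
      exacts [hu, zero_mem _]
    change PowerSeries.coeff n (L (PowerSeries.C u)) ∈ _
    simp only [L, map_sub]
    refine sub_mem ?_ ?_
    · refine coeff_formalProd_mem_vanishing f (coeff_formalProd_mem_vanishing (n := n) g
        fun j _ => hC _ ?_ j) n le_rfl
      rwa [← add_assoc]
    · refine coeff_formalProd_mem_vanishing _ (fun j _ => hC _ (vanishing_antitone ?_ hu) j) n le_rfl
      omega

end LocalStar

/-! ### Wirtinger derivatives -/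

section Wirtinger

open Filter Topology

theorem _root_.Filter.EventuallyEq.dz {φ ψ : ℂ → ℂ} {z : ℂ} (h : φ =ᶠ[𝓝 z] ψ) :
    dz φ =ᶠ[𝓝 z] dz ψ := by
  filter_upwards [h.fderiv (𝕜 := ℝ)] with w hw
  simp only [KahlerStar.dz, hw]

theorem _root_.Filter.EventuallyEq.dzbar {φ ψ : ℂ → ℂ} {z : ℂ} (h : φ =ᶠ[𝓝 z] ψ) :
    dzbar φ =ᶠ[𝓝 z] dzbar ψ := by
  filter_upwards [h.fderiv (𝕜 := ℝ)] with w hw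
  simp only [KahlerStar.dzbar, hw]

theorem dz_add {φ ψ : ℂ → ℂ} {z : ℂ} (hφ : DifferentiableAt ℝ φ z) (hψ : DifferentiableAt ℝ ψ z) :
    dz (φ + ψ) z = dz φ z + dz ψ z := by
  simp only [dz, fderiv_add hφ hψ, add_apply]
  ring

theorem dzbar_add {φ ψ : ℂ → ℂ} {z : ℂ} (hφ : DifferentiableAt ℝ φ z)
    (hψ : DifferentiableAt ℝ ψ z) : dzbar (φ + ψ) z = dzbar φ z + dzbar ψ z := by
  simp only [dzbar, fderiv_add hφ hψ, add_apply]
  ring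

theorem dz_mul {φ ψ : ℂ → ℂ} {z : ℂ} (hφ : DifferentiableAt ℝ φ z) (hψ : DifferentiableAt ℝ ψ z) :
    dz (φ * ψ) z = φ z * dz ψ z + ψ z * dz φ z := by
  simp only [dz, fderiv_mul hφ hψ, add_apply, smul_apply,
    smul_eq_mul]
  ring

theorem dzbar_mul {φ ψ : ℂ → ℂ} {z : ℂ} (hφ : DifferentiableAt ℝ φ z)
    (hψ : DifferentiableAt ℝ ψ z) : dzbar (φ * ψ) z = φ z * dzbar ψ z + ψ z * dzbar φ z := by
  simp only [dzbar, fderiv_mul hφ hψ, add_apply, smul_apply,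
    smul_eq_mul]
  ring

@[simp]
theorem dz_const (c z : ℂ) : dz (fun _ => c) z = 0 := by
  simp [dz]

@[simp]
theorem dzbar_const (c z : ℂ) : dzbar (fun _ => c) z = 0 := by
  simp [dzbar]

theorem contDiffAt_dz {φ : ℂ → ℂ} {z : ℂ} (h : ContDiffAt ℝ ∞ φ z) : ContDiffAt ℝ ∞ (dz φ) z := by
  have h' : ContDiffAt ℝ ∞ (fderiv ℝ φ) z := h.fderiv_right (by simp)
  exact ((h'.clm_apply contDiffAt_const).sub
    (contDiffAt_const.mul (h'.clm_apply contDiffAt_const))).div_const 2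

theorem contDiffAt_dzbar {φ : ℂ → ℂ} {z : ℂ} (h : ContDiffAt ℝ ∞ φ z) :
    ContDiffAt ℝ ∞ (dzbar φ) z := by
  have h' : ContDiffAt ℝ ∞ (fderiv ℝ φ) z := h.fderiv_right (by simp)
  exact ((h'.clm_apply contDiffAt_const).add
    (contDiffAt_const.mul (h'.clm_apply contDiffAt_const))).div_const 2

/-- Symmetry of the second real derivative in the directions 1 and i. -/
theorem dz_dzbar_comm {φ : ℂ → ℂ} {z : ℂ} (h : ContDiffAt ℝ ∞ φ z) :
    dz (dzbar φ) z = dzbar (dz φ) z := by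
  have h' : DifferentiableAt ℝ (fderiv ℝ φ) z :=
    (h.fderiv_right (m := ∞) (by simp)).differentiableAt (by simp)
  have hv (v : ℂ) : HasFDerivAt (fun w => fderiv ℝ φ w v) ((fderiv ℝ (fderiv ℝ φ) z).flip v) z :=
    (ContinuousLinearMap.apply ℝ ℂ v).hasFDerivAt.comp z h'.hasFDerivAt
  have hsymm := (h.isSymmSndFDerivAt (by
    rw [minSmoothness_of_isRCLikeNormedField]
    exact WithTop.coe_le_coe.2 le_top)) 1 Complex.I
  have h1 : fderiv ℝ (dzbar φ) z = (2⁻¹ : ℂ) • ((fderiv ℝ (fderiv ℝ φ) z).flip 1 +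
      Complex.I • (fderiv ℝ (fderiv ℝ φ) z).flip Complex.I) := by
    refine HasFDerivAt.fderiv ?_
    have := ((hv 1).add ((hv Complex.I).const_mul Complex.I)).const_mul (2⁻¹ : ℂ)
    refine this.congr_of_eventuallyEq (Eventually.of_forall fun w => ?_)
    simp [dzbar, div_eq_inv_mul]
  have h2 : fderiv ℝ (dz φ) z = (2⁻¹ : ℂ) • ((fderiv ℝ (fderiv ℝ φ) z).flip 1 -
      Complex.I • (fderiv ℝ (fderiv ℝ φ) z).flip Complex.I) := by
    refine HasFDerivAt.fderiv ?_
    have := ((hv 1).sub ((hv Complex.I).const_mul Complex.I)).const_mul (2⁻¹ : ℂ)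
    refine this.congr_of_eventuallyEq (Eventually.of_forall fun w => ?_)
    simp [dz, div_eq_inv_mul]
  rw [dz, dzbar, h1, h2]
  simp only [smul_apply, add_apply,
    sub_apply, ContinuousLinearMap.flip_apply, smul_eq_mul, hsymm]
  ring

theorem dzbar_eq_zero_of_differentiableAt {φ : ℂ → ℂ} {z : ℂ} (h : DifferentiableAt ℂ φ z) :
    dzbar φ z = 0 := by
  have := (differentiableAt_complex_iff_differentiableAt_real.1 h).2
  rw [dzbar, this, smul_eq_mul, ← mul_assoc, Complex.I_mul_I]
  ring

theorem differentiableAt_of_dzbar_eq_zero {φ : ℂ → ℂ} {z : ℂ} (h : DifferentiableAt ℝ φ z)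
    (h' : dzbar φ z = 0) : DifferentiableAt ℂ φ z := by
  refine differentiableAt_complex_iff_differentiableAt_real.2 ⟨h, ?_⟩
  rw [dzbar] at h'
  rw [smul_eq_mul]
  linear_combination -2 * Complex.I * h' + (fderiv ℝ φ z) Complex.I * Complex.I_mul_I

theorem dz_eq_deriv {φ : ℂ → ℂ} {z : ℂ} (h : DifferentiableAt ℂ φ z) : dz φ z = deriv φ z := by
  have h1 := (h.hasFDerivAt.restrictScalars ℝ).fderiv
  rw [dz, h1]
  have : (fderiv ℂ φ z) Complex.I = Complex.I * deriv φ z := by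
    rw [← fderiv_apply_one_eq_deriv, ← smul_eq_mul, ← map_smul, smul_eq_mul, mul_one]
  simp only [ContinuousLinearMap.coe_restrictScalars', this]
  rw [← mul_assoc, Complex.I_mul_I, fderiv_apply_one_eq_deriv]
  ring

theorem dz_conj {φ : ℂ → ℂ} {z : ℂ} (h : DifferentiableAt ℝ φ z) :
    dz (fun w => (starRingEnd ℂ) (φ w)) z = (starRingEnd ℂ) (dzbar φ z) := by
  have h1 : fderiv ℝ (fun w => (starRingEnd ℂ) (φ w)) z =
      (Complex.conjCLE : ℂ →L[ℝ] ℂ).comp (fderiv ℝ φ z) :=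
    ((Complex.conjCLE : ℂ →L[ℝ] ℂ).hasFDerivAt.comp z h.hasFDerivAt).fderiv
  rw [dz, dzbar, h1, map_div₀, map_ofNat]
  simp
  ring

theorem dzbar_conj {φ : ℂ → ℂ} {z : ℂ} (h : DifferentiableAt ℝ φ z) :
    dzbar (fun w => (starRingEnd ℂ) (φ w)) z = (starRingEnd ℂ) (dz φ z) := by
  have h1 : fderiv ℝ (fun w => (starRingEnd ℂ) (φ w)) z =
      (Complex.conjCLE : ℂ →L[ℝ] ℂ).comp (fderiv ℝ φ z) :=
    ((Complex.conjCLE : ℂ →L[ℝ] ℂ).hasFDerivAt.comp z h.hasFDerivAt).fderiv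
  rw [dz, dzbar, h1, map_div₀, map_ofNat]
  simp

theorem fderiv_apply_eq_wirtinger (φ : ℂ → ℂ) (z v : ℂ) :
    fderiv ℝ φ z v = dz φ z * v + dzbar φ z * (starRingEnd ℂ) v := by
  have hv : v = v.re • (1 : ℂ) + v.im • Complex.I := by
    rw [Complex.real_smul, Complex.real_smul, mul_one, Complex.re_add_im]
  have h2 : fderiv ℝ φ z v = v.re * fderiv ℝ φ z 1 + v.im * fderiv ℝ φ z Complex.I := by
    conv_lhs => rw [hv]
    rw [map_add, map_smul, map_smul]
    simp
  have h3 : (starRingEnd ℂ) v = v.re - v.im * Complex.I := by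
    apply Complex.ext <;> simp
  rw [h2, h3]
  nth_rw 3 [← Complex.re_add_im v]
  rw [dz, dzbar]
  linear_combination ((v.im : ℂ) * fderiv ℝ φ z Complex.I) * Complex.I_mul_I

theorem dz_comp {u φ : ℂ → ℂ} {z : ℂ} (hu : DifferentiableAt ℝ u (φ z))
    (hφ : DifferentiableAt ℂ φ z) : dz (fun w => u (φ w)) z = deriv φ z * dz u (φ z) := by
  have h1 : fderiv ℝ (fun w => u (φ w)) z = (fderiv ℝ u (φ z)).comp (fderiv ℝ φ z) :=
    (hu.hasFDerivAt.comp z (hφ.restrictScalars ℝ).hasFDerivAt).fderiv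
  rw [dz, h1]
  simp only [ContinuousLinearMap.comp_apply, fderiv_apply_eq_wirtinger,
    dzbar_eq_zero_of_differentiableAt hφ, dz_eq_deriv hφ]
  simp
  linear_combination (- deriv φ z * dz u (φ z) / 2 +
    dzbar u (φ z) * (starRingEnd ℂ) (deriv φ z) / 2) * Complex.I_mul_I

theorem dzbar_comp {u φ : ℂ → ℂ} {z : ℂ} (hu : DifferentiableAt ℝ u (φ z))
    (hφ : DifferentiableAt ℂ φ z) :
    dzbar (fun w => u (φ w)) z = (starRingEnd ℂ) (deriv φ z) * dzbar u (φ z) := by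
  have h1 : fderiv ℝ (fun w => u (φ w)) z = (fderiv ℝ u (φ z)).comp (fderiv ℝ φ z) :=
    (hu.hasFDerivAt.comp z (hφ.restrictScalars ℝ).hasFDerivAt).fderiv
  rw [dzbar, h1]
  simp only [ContinuousLinearMap.comp_apply, fderiv_apply_eq_wirtinger,
    dzbar_eq_zero_of_differentiableAt hφ, dz_eq_deriv hφ]
  simp
  linear_combination (deriv φ z * dz u (φ z) / 2 -
    dzbar u (φ z) * (starRingEnd ℂ) (deriv φ z) / 2) * Complex.I_mul_I

end Wirtinger

/-! ### Germs of smooth functions -/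

section Germs

open Filter Topology

/-- Smoothness in a neighborhood of `z`. -/
def SmoothNear (φ : ℂ → ℂ) (z : ℂ) : Prop := ∀ᶠ w in 𝓝 z, ContDiffAt ℝ ∞ φ w

variable {z : ℂ} {φ ψ : ℂ → ℂ}

/-- Germs need one neighbourhood good for all orders, whereas `ContDiffAt ℝ ∞` at a single point
lets the neighbourhood shrink with the order. -/
theorem SmoothNear.contDiffAt (h : SmoothNear φ z) : ContDiffAt ℝ ∞ φ z := h.self_of_nhds

theorem SmoothNear.eventually_differentiableAt (h : SmoothNear φ z) :
    ∀ᶠ w in 𝓝 z, DifferentiableAt ℝ φ w :=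
  h.mono fun _ hw => hw.differentiableAt (by simp)

theorem SmoothNear.add (hφ : SmoothNear φ z) (hψ : SmoothNear ψ z) : SmoothNear (φ + ψ) z :=
  hφ.mp (hψ.mono fun _ h h' => h'.add h)

theorem SmoothNear.mul (hφ : SmoothNear φ z) (hψ : SmoothNear ψ z) : SmoothNear (φ * ψ) z :=
  hφ.mp (hψ.mono fun _ h h' => h'.mul h)

theorem SmoothNear.neg (hφ : SmoothNear φ z) : SmoothNear (-φ) z :=
  hφ.mono fun _ h => h.neg

theorem smoothNear_const (c z : ℂ) : SmoothNear (fun _ => c) z :=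
  Eventually.of_forall fun _ => contDiffAt_const

theorem SmoothNear.inv (hφ : SmoothNear φ z) (h0 : φ z ≠ 0) : SmoothNear φ⁻¹ z := by
  filter_upwards [hφ, hφ.contDiffAt.continuousAt.eventually_ne h0] with w hw hw0
  exact hw.inv hw0

theorem SmoothNear.dz (h : SmoothNear φ z) : SmoothNear (dz φ) z :=
  h.mono fun _ => contDiffAt_dz

theorem SmoothNear.dzbar (h : SmoothNear φ z) : SmoothNear (dzbar φ) z :=
  h.mono fun _ => contDiffAt_dzbar

theorem smoothNear_of_contDiffOn {V : Set ℂ} (h : ContDiffOn ℝ ∞ φ V) (hV : IsOpen V) (hz : z ∈ V) :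
    SmoothNear φ z :=
  (hV.eventually_mem hz).mono fun _ hw => h.contDiffAt (hV.mem_nhds hw)

/-- The ring of germs at `z` of smooth functions. -/
def SmoothGerm (z : ℂ) : Subring (Germ (𝓝 z) ℂ) where
  carrier := {a | ∃ φ : ℂ → ℂ, SmoothNear φ z ∧ (φ : Germ (𝓝 z) ℂ) = a}
  mul_mem' := by
    rintro _ _ ⟨φ, hφ, rfl⟩ ⟨ψ, hψ, rfl⟩
    exact ⟨φ * ψ, hφ.mul hψ, rfl⟩
  add_mem' := by
    rintro _ _ ⟨φ, hφ, rfl⟩ ⟨ψ, hψ, rfl⟩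
    exact ⟨φ + ψ, hφ.add hψ, rfl⟩
  neg_mem' := by
    rintro _ ⟨φ, hφ, rfl⟩
    exact ⟨-φ, hφ.neg, rfl⟩
  zero_mem' := ⟨_, smoothNear_const 0 z, rfl⟩
  one_mem' := ⟨_, smoothNear_const 1 z, rfl⟩

/-- The germ of a function that is smooth near `z`. -/
def germ (φ : ℂ → ℂ) (h : SmoothNear φ z) : SmoothGerm z := ⟨φ, φ, h, rfl⟩

theorem exists_germ_eq (a : SmoothGerm z) : ∃ φ, ∃ h : SmoothNear φ z, germ φ h = a := by
  obtain ⟨_, φ, h, rfl⟩ := a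
  exact ⟨φ, h, rfl⟩

theorem germ_eq_iff (hφ : SmoothNear φ z) (hψ : SmoothNear ψ z) :
    germ φ hφ = germ ψ hψ ↔ φ =ᶠ[𝓝 z] ψ := by
  rw [Subtype.ext_iff]
  exact Germ.coe_eq

theorem germ_add (hφ : SmoothNear φ z) (hψ : SmoothNear ψ z) :
    germ φ hφ + germ ψ hψ = germ (φ + ψ) (hφ.add hψ) := rfl

theorem germ_mul (hφ : SmoothNear φ z) (hψ : SmoothNear ψ z) :
    germ φ hφ * germ ψ hψ = germ (φ * ψ) (hφ.mul hψ) := rfl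

instance : Algebra ℂ (SmoothGerm z) :=
  RingHom.toAlgebra
    { toFun := fun c => germ (fun _ => c) (smoothNear_const c z)
      map_one' := rfl
      map_mul' := fun _ _ => rfl
      map_zero' := rfl
      map_add' := fun _ _ => rfl }

theorem algebraMap_germ (c : ℂ) :
    algebraMap ℂ (SmoothGerm z) c = germ (fun _ => c) (smoothNear_const c z) := rfl

theorem germ_sum {ι : Type*} (s : Finset ι) {φ : ι → ℂ → ℂ} (h : ∀ i, SmoothNear (φ i) z) :
    ∃ h' : SmoothNear (∑ i ∈ s, φ i) z, ∑ i ∈ s, germ (φ i) (h i) = germ (∑ i ∈ s, φ i) h' := by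
  classical
  induction s using Finset.induction_on with
  | empty => exact ⟨smoothNear_const 0 z, rfl⟩
  | insert i s hi ih =>
    obtain ⟨h', e⟩ := ih
    rw [Finset.sum_insert hi, Finset.sum_insert hi, e]
    exact ⟨(h i).add h', rfl⟩

theorem smul_germ (c : ℂ) (hφ : SmoothNear φ z) :
    c • germ φ hφ = germ (fun w => c * φ w) ((smoothNear_const c z).mul hφ) := by
  rw [Algebra.smul_def]
  rfl

/-- The value of a germ. -/
def germEval (z : ℂ) : SmoothGerm z →ₐ[ℂ] ℂ where
  toRingHom := Germ.valueRingHom.comp (SmoothGerm z).subtype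
  commutes' _ := rfl

theorem germEval_germ (hφ : SmoothNear φ z) : germEval z (germ φ hφ) = φ z := rfl

/-- A local operator on functions that preserves smoothness and satisfies the Leibniz rule. -/
structure IsLocalDerivation (δ : (ℂ → ℂ) → ℂ → ℂ) : Prop where
  congr : ∀ {φ ψ : ℂ → ℂ} {z : ℂ}, φ =ᶠ[𝓝 z] ψ → δ φ =ᶠ[𝓝 z] δ ψ
  contDiffAt : ∀ {φ : ℂ → ℂ} {z : ℂ}, ContDiffAt ℝ ∞ φ z → ContDiffAt ℝ ∞ (δ φ) z
  add : ∀ {φ ψ : ℂ → ℂ} {z : ℂ}, DifferentiableAt ℝ φ z → DifferentiableAt ℝ ψ z →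
    δ (φ + ψ) z = δ φ z + δ ψ z
  mul : ∀ {φ ψ : ℂ → ℂ} {z : ℂ}, DifferentiableAt ℝ φ z → DifferentiableAt ℝ ψ z →
    δ (φ * ψ) z = φ z * δ ψ z + ψ z * δ φ z
  const : ∀ c z, δ (fun _ => c) z = 0

theorem isLocalDerivation_dz : IsLocalDerivation dz :=
  ⟨fun h => h.dz, contDiffAt_dz, dz_add, dz_mul, dz_const⟩

theorem isLocalDerivation_dzbar : IsLocalDerivation dzbar :=
  ⟨fun h => h.dzbar, contDiffAt_dzbar, dzbar_add, dzbar_mul, dzbar_const⟩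

namespace IsLocalDerivation

variable {δ : (ℂ → ℂ) → ℂ → ℂ} (hδ : IsLocalDerivation δ)
include hδ

theorem smoothNear (h : SmoothNear φ z) : SmoothNear (δ φ) z := h.mono fun _ => hδ.contDiffAt

theorem iterate_smoothNear (h : SmoothNear φ z) (m : ℕ) : SmoothNear (δ^[m] φ) z := by
  induction m with
  | zero => exact h
  | succ m ih => rw [Function.iterate_succ_apply']; exact hδ.smoothNear ih

theorem sum {ι : Type*} (s : Finset ι) {φ : ι → ℂ → ℂ} {z : ℂ}
    (h : ∀ i ∈ s, DifferentiableAt ℝ (φ i) z) : δ (∑ i ∈ s, φ i) z = ∑ i ∈ s, δ (φ i) z := by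
  classical
  induction s using Finset.induction_on with
  | empty => exact hδ.const 0 z
  | insert i s hi ih =>
    rw [Finset.sum_insert hi, Finset.sum_insert hi, hδ.add (h i (Finset.mem_insert_self i s))
      (DifferentiableAt.sum fun j hj => h j (Finset.mem_insert_of_mem hj)),
      ih fun j hj => h j (Finset.mem_insert_of_mem hj)]

end IsLocalDerivation

/-- The action on germs of a local derivation. -/
def germDerivation (z : ℂ) {δ : (ℂ → ℂ) → ℂ → ℂ} (hδ : IsLocalDerivation δ) :
    Derivation ℂ (SmoothGerm z) (SmoothGerm z) := by
  let F : SmoothGerm z → SmoothGerm z := fun a => ⟨Germ.map' δ (fun _ _ h => hδ.congr h) a.1, by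
    obtain ⟨_, φ, h, rfl⟩ := a
    exact ⟨δ φ, hδ.smoothNear h, rfl⟩⟩
  have hF (φ) (h : SmoothNear φ z) : F (germ φ h) = germ (δ φ) (hδ.smoothNear h) := rfl
  have hFmul (a b) : F (a * b) = a • F b + b • F a := by
    obtain ⟨φ, hφ, rfl⟩ := exists_germ_eq a
    obtain ⟨ψ, hψ, rfl⟩ := exists_germ_eq b
    rw [germ_mul, hF, hF, hF, smul_eq_mul, smul_eq_mul, germ_mul, germ_mul, germ_add, germ_eq_iff]
    filter_upwards [hφ.eventually_differentiableAt, hψ.eventually_differentiableAt] with w h1 h2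
    exact hδ.mul h1 h2
  exact Derivation.mk'
    { toFun := F
      map_add' := fun a b => by
        obtain ⟨φ, hφ, rfl⟩ := exists_germ_eq a
        obtain ⟨ψ, hψ, rfl⟩ := exists_germ_eq b
        rw [germ_add, hF, hF, hF, germ_add, germ_eq_iff]
        filter_upwards [hφ.eventually_differentiableAt, hψ.eventually_differentiableAt] with w h1 h2
        exact hδ.add h1 h2
      map_smul' := fun c a => by
        have hc : F (algebraMap ℂ _ c) = 0 := by
          rw [algebraMap_germ, hF]
          exact (germ_eq_iff _ (smoothNear_const 0 z)).2 (Eventually.of_forall (hδ.const c))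
        rw [Algebra.smul_def, hFmul, hc, smul_zero, add_zero, RingHom.id_apply, smul_eq_mul,
          Algebra.smul_def] }
    hFmul

theorem germDerivation_germ {δ : (ℂ → ℂ) → ℂ → ℂ} (hδ : IsLocalDerivation δ)
    (h : SmoothNear φ z) : germDerivation z hδ (germ φ h) = germ (δ φ) (hδ.smoothNear h) := rfl

theorem iterate_germDerivation_germ {δ : (ℂ → ℂ) → ℂ → ℂ} (hδ : IsLocalDerivation δ)
    (h : SmoothNear φ z) (m : ℕ) :
    (germDerivation z hδ)^[m] (germ φ h) = germ (δ^[m] φ) (hδ.iterate_smoothNear h m) := by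
  induction m with
  | zero => rfl
  | succ m ih =>
    rw [Function.iterate_succ_apply', ih, germDerivation_germ, germ_eq_iff,
      Function.iterate_succ_apply']

/-- `∂` on germs. -/
abbrev germDz (z : ℂ) : Derivation ℂ (SmoothGerm z) (SmoothGerm z) :=
  germDerivation z isLocalDerivation_dz

/-- `∂̄` on germs. -/
abbrev germDzbar (z : ℂ) : Derivation ℂ (SmoothGerm z) (SmoothGerm z) :=
  germDerivation z isLocalDerivation_dzbar

theorem germDz_germDzbar_comm (a : SmoothGerm z) :
    germDz z (germDzbar z a) = germDzbar z (germDz z a) := by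
  obtain ⟨φ, h, rfl⟩ := exists_germ_eq a
  simp only [germDerivation_germ, germ_eq_iff]
  exact h.mono fun w => dz_dzbar_comm

theorem smoothNear_conj (z : ℂ) : SmoothNear (fun w => (starRingEnd ℂ) w) z :=
  Eventually.of_forall fun _ => Complex.conjCLE.contDiff.contDiffAt

/-- The germ of `z̄`. -/
def germConj (z : ℂ) : SmoothGerm z := germ _ (smoothNear_conj z)

theorem germDz_germConj (z : ℂ) : germDz z (germConj z) = 0 := by
  refine (germ_eq_iff (smoothNear_conj z).dz (smoothNear_const 0 z)).2
    (Eventually.of_forall fun w => ?_)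
  rw [dz_conj (φ := fun w => w) differentiableAt_fun_id,
    dzbar_eq_zero_of_differentiableAt differentiableAt_fun_id, map_zero]

theorem germDzbar_germConj (z : ℂ) : germDzbar z (germConj z) = 1 := by
  refine (germ_eq_iff (smoothNear_conj z).dzbar (smoothNear_const 1 z)).2
    (Eventually.of_forall fun w => ?_)
  rw [dzbar_conj (φ := fun w => w) differentiableAt_fun_id, dz_eq_deriv differentiableAt_fun_id]
  simp

end Germs

/-! ### Smooth functions in holomorphic charts -/

section Charts

open Filter Topology

/-- Holomorphic transition maps are smooth over ℝ, so every holomorphic chart is also a chart of the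
underlying real manifold and smooth functions may be read in it. -/
theorem contDiffGroupoid_complex_le_real :
    contDiffGroupoid ω 𝓘(ℂ) ≤ contDiffGroupoid ∞ 𝓘(ℝ, ℂ) := by
  have key (f : ℂ → ℂ) (s : Set ℂ) (h : ContDiffOn ℂ ω f s) : ContDiffOn ℝ ∞ f s :=
    (h.restrict_scalars ℝ).of_le le_top
  intro e he
  change e ∈ contDiffGroupoid ω 𝓘(ℂ) at he
  change e ∈ contDiffGroupoid ∞ 𝓘(ℝ, ℂ)
  rw [contDiffGroupoid, mem_groupoid_of_pregroupoid] at he ⊢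
  simp only [contDiffPregroupoid, modelWithCornersSelf_coe, modelWithCornersSelf_coe_symm,
    Set.range_id, Set.inter_univ, Set.preimage_id, Function.id_comp, Function.comp_id] at he ⊢
  exact ⟨key _ _ he.1, key _ _ he.2⟩

variable {M : Type*} [TopologicalSpace M] [ChartedSpace ℂ M]

theorem IsHolChart.mem_real {e : OpenPartialHomeomorph M ℂ} (he : IsHolChart M e) :
    e ∈ IsManifold.maximalAtlas 𝓘(ℝ, ℂ) ∞ M :=
  StructureGroupoid.maximalAtlas_mono contDiffGroupoid_complex_le_real he

theorem isHolChart_chartAt [IsManifold 𝓘(ℂ) ω M] (p : M) : IsHolChart M (chartAt ℂ p) :=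
  IsManifold.chart_mem_maximalAtlas p

variable {e e' : OpenPartialHomeomorph M ℂ}

theorem contMDiffAt_iff_contDiffAt_chart (he : IsHolChart M e) {f : M → ℂ} {z : ℂ}
    (hz : z ∈ e.target) :
    ContMDiffAt 𝓘(ℝ, ℂ) 𝓘(ℝ, ℂ) ∞ f (e.symm z) ↔ ContDiffAt ℝ ∞ (fun w => f (e.symm w)) z := by
  rw [← contMDiffAt_iff_contDiffAt]
  have hsymm : ContMDiffAt 𝓘(ℝ, ℂ) 𝓘(ℝ, ℂ) ∞ e.symm z :=
    (contMDiffOn_symm_of_mem_maximalAtlas he.mem_real).contMDiffAt (e.open_target.mem_nhds hz)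
  have hchart : ContMDiffAt 𝓘(ℝ, ℂ) 𝓘(ℝ, ℂ) ∞ e (e.symm z) :=
    (contMDiffOn_of_mem_maximalAtlas he.mem_real).contMDiffAt
      (e.open_source.mem_nhds (e.map_target hz))
  refine ⟨fun h => h.comp z hsymm, fun h => ?_⟩
  have h' : ContMDiffAt 𝓘(ℝ, ℂ) 𝓘(ℝ, ℂ) ∞ (fun w => f (e.symm w)) (e (e.symm z)) := by
    rwa [e.right_inv hz]
  refine (h'.comp (e.symm z) hchart).congr_of_eventuallyEq ?_
  filter_upwards [e.open_source.mem_nhds (e.map_target hz)] with q hq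
  simp [e.left_inv hq]

theorem mdifferentiableAt_iff_differentiableAt_chart (he : IsHolChart M e) {f : M → ℂ} {z : ℂ}
    (hz : z ∈ e.target) :
    MDifferentiableAt 𝓘(ℂ) 𝓘(ℂ) f (e.symm z) ↔ DifferentiableAt ℂ (fun w => f (e.symm w)) z := by
  rw [← mdifferentiableAt_iff_differentiableAt]
  have hsymm : MDifferentiableAt 𝓘(ℂ) 𝓘(ℂ) e.symm z :=
    ((contMDiffOn_symm_of_mem_maximalAtlas he).contMDiffAt
      (e.open_target.mem_nhds hz)).mdifferentiableAt (by simp)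
  have hchart : MDifferentiableAt 𝓘(ℂ) 𝓘(ℂ) e (e.symm z) :=
    ((contMDiffOn_of_mem_maximalAtlas he).contMDiffAt
      (e.open_source.mem_nhds (e.map_target hz))).mdifferentiableAt (by simp)
  refine ⟨fun h => h.comp z hsymm, fun h => ?_⟩
  have h' : MDifferentiableAt 𝓘(ℂ) 𝓘(ℂ) (fun w => f (e.symm w)) (e (e.symm z)) := by
    rwa [e.right_inv hz]
  refine (h'.comp (e.symm z) hchart).congr_of_eventuallyEq ?_
  filter_upwards [e.open_source.mem_nhds (e.map_target hz)] with q hq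
  simp [e.left_inv hq]

theorem differentiableAt_transition (he : IsHolChart M e) (he' : IsHolChart M e') {z : ℂ}
    (hz : z ∈ (e.symm ≫ₕ e').source) : DifferentiableAt ℂ (fun w => e' (e.symm w)) z := by
  rw [OpenPartialHomeomorph.trans_source] at hz
  rw [← mdifferentiableAt_iff_differentiableAt_chart he hz.1]
  exact ((contMDiffOn_of_mem_maximalAtlas he').contMDiffAt
      (e'.open_source.mem_nhds hz.2)).mdifferentiableAt (by simp)

theorem contDiffOn_inChart (he : IsHolChart M e) (f : SmoothFun M) :
    ContDiffOn ℝ ∞ (inChart e f) e.target := fun _ hz =>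
  ((contMDiffAt_iff_contDiffAt_chart he hz).1 (f.2 _)).contDiffWithinAt

theorem smoothNear_inChart (he : IsHolChart M e) {z : ℂ} (hz : z ∈ e.target) (f : SmoothFun M) :
    SmoothNear (inChart e f) z :=
  smoothNear_of_contDiffOn (contDiffOn_inChart he f) e.open_target hz

/-- The germ in a chart of a smooth function. -/
def restrictGerm (he : IsHolChart M e) {z : ℂ} (hz : z ∈ e.target) :
    SmoothFun M →ₐ[ℂ] SmoothGerm z where
  toFun f := germ (inChart e f) (smoothNear_inChart he hz f)
  map_one' := rfl
  map_mul' _ _ := rfl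
  map_zero' := rfl
  map_add' _ _ := rfl
  commutes' _ := rfl

theorem restrictGerm_apply (he : IsHolChart M e) {z : ℂ} (hz : z ∈ e.target) (f : SmoothFun M) :
    restrictGerm he hz f = germ (inChart e f) (smoothNear_inChart he hz f) := rfl

/-- Multiply a representative by a bump function supported inside the chart and extend by zero. The
result has the same germ, because the bump is 1 near the centre. -/
theorem restrictGerm_surjective [T2Space M] (he : IsHolChart M e) {z : ℂ} (hz : z ∈ e.target) :
    Function.Surjective (restrictGerm he hz) := by
  intro a
  obtain ⟨φ, hφ, rfl⟩ := exists_germ_eq a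
  obtain ⟨r, hr, hball⟩ := Metric.nhds_basis_closedBall.mem_iff.1
    (inter_mem hφ (e.open_target.mem_nhds hz))
  let χ : ContDiffBump z := ⟨r / 2, r, by positivity, by linarith⟩
  have hsmooth (w : ℂ) : ContDiffAt ℝ ∞ (fun w => (χ w : ℂ) * φ w) w := by
    by_cases hw : w ∈ Metric.closedBall z r
    · exact (Complex.ofRealCLM.contDiff.contDiffAt.comp w χ.contDiff.contDiffAt).mul (hball hw).1
    · refine (contDiffAt_const (c := (0 : ℂ))).congr_of_eventuallyEq ?_
      filter_upwards [Metric.isClosed_closedBall.isOpen_compl.mem_nhds hw] with v hv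
      have : χ v = 0 := χ.zero_of_le_dist (by
        rw [Set.mem_compl_iff, Metric.mem_closedBall, not_le] at hv
        exact hv.le)
      simp [this]
  classical
  let F : M → ℂ := fun p => if p ∈ e.source then (χ (e p) : ℂ) * φ (e p) else 0
  have hF (w : ℂ) (hw : w ∈ e.target) : F (e.symm w) = (χ w : ℂ) * φ w := by
    simp [F, e.map_target hw, e.right_inv hw]
  have hFs : ContMDiff 𝓘(ℝ, ℂ) 𝓘(ℝ, ℂ) ∞ F := by
    intro p
    by_cases hp : p ∈ e.source
    · rw [← e.left_inv hp, contMDiffAt_iff_contDiffAt_chart he (e.map_source hp)]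
      refine (hsmooth _).congr_of_eventuallyEq ?_
      filter_upwards [e.open_target.mem_nhds (e.map_source hp)] with w hw using hF w hw
    · refine (contMDiffAt_const (c := (0 : ℂ))).congr_of_eventuallyEq ?_
      -- The support is compact, hence closed in the Hausdorff space M; without closedness the
      -- extension by zero could fail to be smooth at points outside the chart.
      have hK : IsClosed (e.symm '' Metric.closedBall z r) :=
        ((isCompact_closedBall z r).image_of_continuousOn
          (e.continuousOn_symm.mono fun w hw => (hball hw).2)).isClosed
      have hpK : p ∉ e.symm '' Metric.closedBall z r := by
        rintro ⟨w, hw, rfl⟩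
        exact hp (e.map_target (hball hw).2)
      filter_upwards [hK.isOpen_compl.mem_nhds hpK] with q hq
      by_cases hqs : q ∈ e.source
      · have : χ (e q) = 0 := χ.zero_of_le_dist (by
          by_contra! h
          exact hq ⟨e q, h.le, e.left_inv hqs⟩)
        simp [F, this]
      · simp [F, hqs]
  refine ⟨⟨F, hFs⟩, ?_⟩
  rw [restrictGerm_apply, germ_eq_iff]
  filter_upwards [e.open_target.mem_nhds hz, χ.eventuallyEq_one] with w hw h1
  change F (e.symm w) = _
  rw [hF w hw, h1]
  simp

theorem smoothFun_ext [IsManifold 𝓘(ℂ) ω M] {f g : SmoothFun M}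
    (h : ∀ e, IsHolChart M e → ∀ z ∈ e.target, inChart e f z = inChart e g z) : f = g := by
  refine Subtype.ext (funext fun p => ?_)
  have := h _ (isHolChart_chartAt p) _ (mem_chart_target ℂ p)
  simpa [inChart] using this

end Charts

/-! ### Germs of the metric -/

section Metric

open Filter Topology

variable {M : Type*} [TopologicalSpace M] [ChartedSpace ℂ M] (G : KahlerMetric M)
  {e e' : OpenPartialHomeomorph M ℂ}

namespace KahlerMetric

theorem contDiffOn_g (he : IsHolChart M e) : ContDiffOn ℝ ∞ (G.g e) e.target :=
  Complex.ofRealCLM.contDiff.comp_contDiffOn (G.smooth e he)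

theorem g_ne_zero (he : IsHolChart M e) {z : ℂ} (hz : z ∈ e.target) : G.g e z ≠ 0 :=
  Complex.ofReal_ne_zero.2 (G.pos e he z hz).ne'

theorem smoothNear_g (he : IsHolChart M e) {z : ℂ} (hz : z ∈ e.target) : SmoothNear (G.g e) z :=
  smoothNear_of_contDiffOn (G.contDiffOn_g he) e.open_target hz

/-- The germ of `g_{1 1̄}`. -/
def gGerm (he : IsHolChart M e) {z : ℂ} (hz : z ∈ e.target) : SmoothGerm z :=
  germ (G.g e) (G.smoothNear_g he hz)

/-- The germ of `g^{1 1̄}`. -/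
def gInvGerm (he : IsHolChart M e) {z : ℂ} (hz : z ∈ e.target) : SmoothGerm z :=
  germ (G.g e)⁻¹ ((G.smoothNear_g he hz).inv (G.g_ne_zero he hz))

theorem gGerm_mul_gInvGerm (he : IsHolChart M e) {z : ℂ} (hz : z ∈ e.target) :
    G.gGerm he hz * G.gInvGerm he hz = 1 := by
  refine (germ_eq_iff ((G.smoothNear_g he hz).mul
    ((G.smoothNear_g he hz).inv (G.g_ne_zero he hz))) (smoothNear_const 1 z)).2 ?_
  filter_upwards [e.open_target.mem_nhds hz] with w hw
  exact mul_inv_cancel₀ (G.g_ne_zero he hw)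

theorem exists_potential (he : IsHolChart M e) {z : ℂ} (hz : z ∈ e.target) :
    ∃ (V : Set ℂ) (Φ : ℂ → ℝ), IsOpen V ∧ z ∈ V ∧ V ⊆ e.target ∧ ContDiffOn ℝ ∞ Φ V ∧
      (∀ w ∈ V, dz (dzbar fun w => (Φ w : ℂ)) w = G.g e w) := by
  obtain ⟨V, hV, hzV, hVe, Φ, hΦ, h⟩ := G.potential e he z hz
  exact ⟨V, Φ, hV, hzV, hVe, hΦ, h⟩

end KahlerMetric

theorem smoothNear_potential {V : Set ℂ} {Φ : ℂ → ℝ} (hΦ : ContDiffOn ℝ ∞ Φ V) (hV : IsOpen V)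
    {z : ℂ} (hz : z ∈ V) : SmoothNear (dzbar fun w => (Φ w : ℂ)) z :=
  (smoothNear_of_contDiffOn (Complex.ofRealCLM.contDiff.comp_contDiffOn hΦ) hV hz).dzbar

end Metric

/-! ### Uniqueness of the star product with separation of variables -/

section Uniqueness

open Filter Topology

theorem iterate_d_mem_vanishing {A : Type*} [CommRing A] [Algebra ℂ A] {d d' : Derivation ℂ A A}
    {ev : A →ₐ[ℂ] ℂ} (m K : ℕ) {u : A} (hu : u ∈ vanishing d d' ev (m + K)) :
    d^[m] u ∈ vanishing d d' ev K := by
  induction m generalizing u with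
  | zero => simpa using hu
  | succ m ih =>
    rw [Function.iterate_succ_apply]
    refine ih ?_
    rw [show m + 1 + K = m + K + 1 by ring, mem_vanishing_succ] at hu
    exact hu.2.1

theorem iterate_dbar_mem_vanishing {A : Type*} [CommRing A] [Algebra ℂ A] {d d' : Derivation ℂ A A}
    {ev : A →ₐ[ℂ] ℂ} (m K : ℕ) {u : A} (hu : u ∈ vanishing d d' ev (m + K)) :
    d'^[m] u ∈ vanishing d d' ev K := by
  induction m generalizing u with
  | zero => simpa using hu
  | succ m ih =>
    rw [Function.iterate_succ_apply]
    refine ih ?_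
    rw [show m + 1 + K = m + K + 1 by ring, mem_vanishing_succ] at hu
    exact hu.2.2

variable {M : Type*} [TopologicalSpace M] [ChartedSpace ℂ M] {G : KahlerMetric M}
  {e : OpenPartialHomeomorph M ℂ}

theorem IsBidifferential.exists_order {B : SmoothFun M →ₗ[ℂ] SmoothFun M →ₗ[ℂ] SmoothFun M}
    (hB : IsBidifferential B) (he : IsHolChart M e) {z : ℂ} (hz : z ∈ e.target) (f : SmoothFun M) :
    ∃ N, ∀ K u, restrictGerm he hz u ∈ vanishing (germDz z) (germDzbar z) (germEval z) (N + K) →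
      restrictGerm he hz (B f u) ∈ vanishing (germDz z) (germDzbar z) (germEval z) K := by
  obtain ⟨N, hN⟩ := hB
  obtain ⟨a, ha, hBa⟩ := hN e he
  -- Up to `N` derivatives of each of the two types ∂ and ∂̄ fall on `u`.
  refine ⟨N + N, fun K u hu => ?_⟩
  have hs (k l : ℕ) (g : SmoothFun M) : SmoothNear (dz^[k] (dzbar^[l] (inChart e g))) z :=
    isLocalDerivation_dz.iterate_smoothNear
      (isLocalDerivation_dzbar.iterate_smoothNear (smoothNear_inChart he hz g) l) k
  have hterm (p : ℕ × ℕ × ℕ × ℕ) :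
      SmoothNear (a p.1 p.2.1 p.2.2.1 p.2.2.2 * dz^[p.1] (dzbar^[p.2.1] (inChart e f)) *
        dz^[p.2.2.1] (dzbar^[p.2.2.2] (inChart e u))) z :=
    ((smoothNear_of_contDiffOn (ha _ _ _ _) e.open_target hz).mul (hs _ _ f)).mul (hs _ _ u)
  set I := Finset.range (N + 1)
  obtain ⟨h', hsum⟩ := germ_sum (I ×ˢ I ×ˢ I ×ˢ I) hterm
  have hrep : restrictGerm he hz (B f u) = ∑ p ∈ I ×ˢ I ×ˢ I ×ˢ I, germ _ (hterm p) := by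
    rw [hsum, restrictGerm_apply, germ_eq_iff]
    filter_upwards [e.open_target.mem_nhds hz] with w hw
    rw [hBa f u w hw]
    simp only [Finset.sum_apply, Pi.mul_apply, Finset.sum_product]
  rw [hrep]
  refine Submodule.sum_mem _ fun p hp => ?_
  simp only [Finset.mem_product, I, Finset.mem_range] at hp
  rw [← germ_mul ((smoothNear_of_contDiffOn (ha _ _ _ _) e.open_target hz).mul (hs _ _ f))
    (hs _ _ u)]
  refine mul_mem_vanishing _ ?_
  rw [← iterate_germDerivation_germ isLocalDerivation_dz
      (isLocalDerivation_dzbar.iterate_smoothNear (smoothNear_inChart he hz u) _),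
    ← iterate_germDerivation_germ isLocalDerivation_dzbar (smoothNear_inChart he hz u)]
  refine iterate_d_mem_vanishing _ _ (iterate_dbar_mem_vanishing _ _ (vanishing_antitone ?_ hu))
  omega

/-- Makes the identities proved over an arbitrary algebra available for the star product on M. -/
theorem starProd_eq_formalProd (C : ℕ → SmoothFun M →ₗ[ℂ] SmoothFun M →ₗ[ℂ] SmoothFun M)
    (f g : (SmoothFun M)⟦X⟧) : starProd C f g = formalProd C f g := rfl

theorem evalAt_eq_iff {p : M} {F F' : (SmoothFun M)⟦X⟧} :
    evalAt p F = evalAt p F' ↔ ∀ n, ((PowerSeries.coeff n F : SmoothFun M) : M → ℂ) p =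
      ((PowerSeries.coeff n F' : SmoothFun M) : M → ℂ) p := by
  simp [PowerSeries.ext_iff, evalAt]

namespace IsStarProductWithSeparation

variable {C : ℕ → SmoothFun M →ₗ[ℂ] SmoothFun M →ₗ[ℂ] SmoothFun M}
  (hC : IsStarProductWithSeparation G C)
include hC

/-- The commutation axiom speaks of functions satisfying equations on an open set. Equations between
germs hold on some smaller open set containing z, and the axiom is applied there. -/
theorem restrictGerm_potential (he : IsHolChart M e) {V : Set ℂ} {Φ : ℂ → ℝ} (hV : IsOpen V)
    (hVe : V ⊆ e.target) (hΦ : ContDiffOn ℝ ∞ Φ V)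
    (hg : ∀ w ∈ V, dz (dzbar fun w => (Φ w : ℂ)) w = G.g e w) {z : ℂ} (hz : z ∈ V)
    (n : ℕ) (f u v w : SmoothFun M)
    (hv : restrictGerm he (hVe hz) v =
      germ _ (smoothNear_potential hΦ hV hz) * restrictGerm he (hVe hz) u)
    (hw : restrictGerm he (hVe hz) w = germDzbar z (restrictGerm he (hVe hz) u)) :
    restrictGerm he (hVe hz) (C (n + 1) f v) + restrictGerm he (hVe hz) (C n f w) =
      germ _ (smoothNear_potential hΦ hV hz) * restrictGerm he (hVe hz) (C (n + 1) f u) +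
        germDzbar z (restrictGerm he (hVe hz) (C n f u)) := by
  simp only [restrictGerm_apply, germ_mul, germ_add, germDerivation_germ, germ_eq_iff] at hv hw ⊢
  obtain ⟨W, hW, hWo, hzW⟩ := eventually_nhds_iff.1 ((hV.eventually_mem hz).and (hv.and hw))
  filter_upwards [hWo.mem_nhds hzW] with q hq
  have h := hC.commutes e he W Φ hWo (fun q hq => hVe (hW q hq).1) (hΦ.mono fun q hq => (hW q hq).1)
    (fun q hq => hg q (hW q hq).1) f u v w (fun q hq => (hW q hq).2.1) (fun q hq => (hW q hq).2.2)
    (n + 1) q hq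
  simp only [starProd_eq_formalProd, formalProd_add, formalProd_X_mul, map_add,
    PowerSeries.coeff_succ_X_mul, coeff_formalProd_C_C] at h
  exact h

theorem restrictGerm_potential_zero (he : IsHolChart M e) {z : ℂ} (hz : z ∈ e.target)
    (f u v : SmoothFun M) (y : SmoothGerm z) (hv : restrictGerm he hz v = y * restrictGerm he hz u) :
    restrictGerm he hz (C 0 f v) = y * restrictGerm he hz (C 0 f u) := by
  rw [hC.zero_eq, hC.zero_eq, map_mul, map_mul, hv]
  ring

/-- If ∂b vanishes as a germ, it vanishes on an open set, where the conjugate of b satisfies the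
Cauchy–Riemann equation; the separation axiom applies on that set. -/
theorem restrictGerm_antiholomorphic (he : IsHolChart M e) {z : ℂ} (hz : z ∈ e.target) (n : ℕ)
    (f b : SmoothFun M) (hb : germDz z (restrictGerm he hz b) = 0) :
    restrictGerm he hz (C n f b) =
      restrictGerm he hz (PowerSeries.coeff n (PowerSeries.C f * PowerSeries.C b)) := by
  rw [restrictGerm_apply, germDerivation_germ] at hb
  have hb' : dz (inChart e b) =ᶠ[𝓝 z] fun _ => 0 :=
    (germ_eq_iff (smoothNear_inChart he hz b).dz (smoothNear_const 0 z)).1 hb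
  rw [restrictGerm_apply, restrictGerm_apply, germ_eq_iff]
  obtain ⟨W, hW, hWo, hzW⟩ := eventually_nhds_iff.1 ((e.open_target.eventually_mem hz).and hb')
  filter_upwards [hWo.mem_nhds hzW] with q hq
  have h := hC.antiholomorphic (e.source ∩ e ⁻¹' W) b (e.isOpen_inter_preimage hWo) ?_
    (PowerSeries.C f) (e.symm q)
    ⟨e.map_target (hW q hq).1, by rwa [Set.mem_preimage, e.right_inv (hW q hq).1]⟩
  · rw [evalAt_eq_iff] at h
    have hn := h n
    rw [starProd_eq_formalProd, coeff_formalProd_C_C] at hn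
    exact hn
  · rintro p ⟨hp, hpW⟩
    rw [← e.left_inv hp]
    refine ((mdifferentiableAt_iff_differentiableAt_chart he
      (e.map_source hp)).2 ?_).mdifferentiableWithinAt
    have hd : DifferentiableAt ℝ (inChart e b) (e p) :=
      (smoothNear_inChart he (e.map_source hp) b).contDiffAt.differentiableAt (by simp)
    refine differentiableAt_of_dzbar_eq_zero
      (Complex.conjCLE.differentiable.differentiableAt.comp _ hd) ?_
    rw [show (fun w => (starRingEnd ℂ) ((b : M → ℂ) (e.symm w))) =
      fun w => (starRingEnd ℂ) (inChart e b w) from rfl, dzbar_conj hd, (hW _ hpW).2, map_zero]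

end IsStarProductWithSeparation

theorem germ_potential_adapted (he : IsHolChart M e) {V : Set ℂ} {Φ : ℂ → ℝ} (hV : IsOpen V)
    (hVe : V ⊆ e.target) (hΦ : ContDiffOn ℝ ∞ Φ V)
    (hg : ∀ w ∈ V, dz (dzbar fun w => (Φ w : ℂ)) w = G.g e w) {z : ℂ} (hz : z ∈ V) :
    germDz z (germ _ (smoothNear_potential hΦ hV hz)) = G.gGerm he (hVe hz) := by
  rw [germDerivation_germ, KahlerMetric.gGerm, germ_eq_iff]
  filter_upwards [hV.mem_nhds hz] with w hw using hg w hw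

/-- There is at most one star product with separation of variables. -/
theorem IsStarProductWithSeparation.unique [T2Space M] [IsManifold 𝓘(ℂ) ω M]
    {C C' : ℕ → SmoothFun M →ₗ[ℂ] SmoothFun M →ₗ[ℂ] SmoothFun M}
    (hC : IsStarProductWithSeparation G C) (hC' : IsStarProductWithSeparation G C') : C = C' := by
  refine funext fun n => LinearMap.ext fun f => LinearMap.ext fun u =>
    smoothFun_ext fun e he z hz => ?_
  obtain ⟨V, Φ, hV, hzV, hVe, hΦ, hg⟩ := G.exists_potential he hz
  have hd := germ_potential_adapted he hV hVe hΦ hg hzV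
  have HA : AdaptedCoordinates (germDz z) (germDzbar z) (germConj z)
      (germ _ (smoothNear_potential hΦ hV hzV)) (G.gInvGerm he hz) :=
    ⟨germDz_germDzbar_comm, by rw [hd, G.gGerm_mul_gInvGerm he hz], germDz_germConj z,
      germDzbar_germConj z⟩
  -- The difference of the two left multiplications by f. It inherits the commutation relation and
  -- kills antiholomorphic germs, since there both products are pointwise; vanishing to order 1 is
  -- then equality of values.
  let T : ℕ → SmoothFun M →ₗ[ℂ] SmoothGerm z := fun n =>
    (restrictGerm he hz).toLinearMap ∘ₗ (C n f - C' n f)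
  have hT (n u) : T n u = restrictGerm he hz (C n f u) - restrictGerm he hz (C' n f u) := by
    simp [T]
  have h := HA.mem_vanishing_of_commutes (ev := germEval z) (restrictGerm he hz).toLinearMap
    (restrictGerm_surjective he hz) T ?_ ?_ ?_ ?_ n u 1
  · rw [mem_vanishing_succ, hT, map_sub, sub_eq_zero] at h
    exact h.1
  · intro u v h
    rw [hT, hT, hC.restrictGerm_potential_zero he hz f u v _ h,
      hC'.restrictGerm_potential_zero he hz f u v _ h]
    ring
  · intro n u v w h h'
    rw [hT, hT, hT, hT, map_sub]
    linear_combination hC.restrictGerm_potential he hV hVe hΦ hg hzV n f u v w h h' -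
      hC'.restrictGerm_potential he hV hVe hΦ hg hzV n f u v w h h'
  · intro n b hb
    rw [hT, hC.restrictGerm_antiholomorphic he hz n f b hb,
      hC'.restrictGerm_antiholomorphic he hz n f b hb, sub_self]
  · intro n
    obtain ⟨N, hN⟩ := (hC.bidifferential n).exists_order he hz f
    obtain ⟨N', hN'⟩ := (hC'.bidifferential n).exists_order he hz f
    refine ⟨N + N', fun K u hu => ?_⟩
    rw [hT]
    exact sub_mem (hN K u (vanishing_antitone (by omega) hu))
      (hN' K u (vanishing_antitone (by omega) hu))

end Uniqueness

/-! ### The curvature component -/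

section Curvature

open Filter Topology

/-- No Christoffel symbol mixes 1 and 1̄, so only the derivative of Γ^1_{11} survives. -/
theorem riemann_one_zero (h : ℂ → ℂ) :
    riemann h 1 0 0 0 = dzbar (h⁻¹ * dz h) := by
  have h0 : christoffel h 0 0 0 = h⁻¹ * dz h := by
    funext z
    simp [christoffel, wirt]
  have h1 : christoffel h 0 1 0 = fun _ => 0 := by
    funext z
    simp [christoffel]
  funext z
  rw [riemann, h0, h1]
  simp [wirt, christoffel]

/-- The upper index 1 contributes +Γ, the two lower indices 1 contribute -Γ each, and 1̄ contributes
nothing. Up to the factor h⁻¹ the net result is the ∂-derivative of h⁻¹ times the curvature. -/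
theorem covRiemann_zero (h : ℂ → ℂ) (z : ℂ) :
    covRiemann h 0 1 0 0 0 z =
      dz (riemann h 1 0 0 0) z - (h z)⁻¹ * dz h z * riemann h 1 0 0 0 z := by
  simp [covRiemann, christoffel, wirt]
  ring

theorem covRiemann_one (h : ℂ → ℂ) (z : ℂ) :
    covRiemann h 1 1 0 0 0 z =
      dzbar (riemann h 1 0 0 0) z - (h z)⁻¹ * dzbar h z * riemann h 1 0 0 0 z := by
  simp [covRiemann, christoffel, wirt]
  ring

theorem curvatureComponent_eq (h : ℂ → ℂ) {z : ℂ} (hz : h z ≠ 0) :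
    curvatureComponent h z = (h⁻¹ * dzbar (h⁻¹ * dz h)) z := by
  rw [curvatureComponent, riemann_one_zero, Pi.mul_apply, Pi.inv_apply]
  field_simp

variable {M : Type*} [TopologicalSpace M] [ChartedSpace ℂ M] {G : KahlerMetric M}
  {e e' : OpenPartialHomeomorph M ℂ}

/-! ### Reality and local constancy of the curvature component. -/

namespace KahlerMetric

theorem smoothNear_gInv (G : KahlerMetric M) (he : IsHolChart M e) {z : ℂ} (hz : z ∈ e.target) :
    SmoothNear (G.g e)⁻¹ z :=
  (G.smoothNear_g he hz).inv (G.g_ne_zero he hz)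

theorem smoothNear_connection (G : KahlerMetric M) (he : IsHolChart M e) {z : ℂ}
    (hz : z ∈ e.target) : SmoothNear ((G.g e)⁻¹ * dz (G.g e)) z :=
  (G.smoothNear_gInv he hz).mul (G.smoothNear_g he hz).dz

theorem smoothNear_curvature (G : KahlerMetric M) (he : IsHolChart M e) {z : ℂ}
    (hz : z ∈ e.target) : SmoothNear ((G.g e)⁻¹ * dzbar ((G.g e)⁻¹ * dz (G.g e))) z :=
  (G.smoothNear_gInv he hz).mul (G.smoothNear_connection he hz).dzbar

theorem curvatureComponent_eventuallyEq (G : KahlerMetric M) (he : IsHolChart M e) {z : ℂ}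
    (hz : z ∈ e.target) :
    curvatureComponent (G.g e) =ᶠ[𝓝 z] (G.g e)⁻¹ * dzbar ((G.g e)⁻¹ * dz (G.g e)) := by
  filter_upwards [e.open_target.mem_nhds hz] with w hw
  exact curvatureComponent_eq _ (G.g_ne_zero he hw)

theorem derivation_gInvGerm (G : KahlerMetric M) (he : IsHolChart M e) {z : ℂ} (hz : z ∈ e.target)
    (δ : Derivation ℂ (SmoothGerm z) (SmoothGerm z)) :
    δ (G.gInvGerm he hz) = -(G.gInvGerm he hz * G.gInvGerm he hz) * δ (G.gGerm he hz) := by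
  have h := congrArg δ (G.gGerm_mul_gInvGerm he hz)
  rw [Derivation.leibniz, Derivation.map_one_eq_zero, smul_eq_mul, smul_eq_mul] at h
  linear_combination G.gInvGerm he hz * h - δ (G.gInvGerm he hz) * G.gGerm_mul_gInvGerm he hz

/-- Both sides are ∂∂̄ log g, written without the logarithm. -/
theorem germDz_dzbar_log (G : KahlerMetric M) (he : IsHolChart M e) {z : ℂ} (hz : z ∈ e.target) :
    germDz z (G.gInvGerm he hz * germDzbar z (G.gGerm he hz)) =
      germDzbar z (G.gInvGerm he hz * germDz z (G.gGerm he hz)) := by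
  rw [Derivation.leibniz, Derivation.leibniz, G.derivation_gInvGerm, G.derivation_gInvGerm,
    germDz_germDzbar_comm]
  simp only [smul_eq_mul]
  ring

theorem conj_g (G : KahlerMetric M) (e : OpenPartialHomeomorph M ℂ) :
    (fun w => (starRingEnd ℂ) (G.g e w)) = G.g e :=
  funext fun _ => Complex.conj_ofReal _

/-- The metric is real and conjugation exchanges ∂ and ∂̄, so reality is the symmetry of ∂∂̄ log g.
-/
theorem conj_curvatureComponent (G : KahlerMetric M) (he : IsHolChart M e) {z : ℂ}
    (hz : z ∈ e.target) :
    (starRingEnd ℂ) (curvatureComponent (G.g e) z) = curvatureComponent (G.g e) z := by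
  rw [curvatureComponent_eq _ (G.g_ne_zero he hz), Pi.mul_apply, map_mul, Pi.inv_apply, map_inv₀,
    show (starRingEnd ℂ) (G.g e z) = G.g e z from Complex.conj_ofReal _]
  congr 1
  have hd := (G.smoothNear_connection he hz).contDiffAt.differentiableAt (by simp)
  rw [← dz_conj hd]
  have hconj : (fun w => (starRingEnd ℂ) (((G.g e)⁻¹ * dz (G.g e)) w)) =ᶠ[𝓝 z]
      (G.g e)⁻¹ * dzbar (G.g e) := by
    filter_upwards [G.smoothNear_g he hz] with w hw
    rw [Pi.mul_apply, Pi.mul_apply, map_mul, ← dzbar_conj (hw.differentiableAt (by simp)), G.conj_g,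
      Pi.inv_apply, map_inv₀, show (starRingEnd ℂ) (G.g e w) = G.g e w from Complex.conj_ofReal _]
  rw [hconj.dz.self_of_nhds]
  have h := congrArg (germEval z) (G.germDz_dzbar_log he hz)
  exact h

/-- The components m = 1 and m = 1̄ of ∇R = 0 say that ∂ and ∂̄ of the curvature component vanish.
Its real derivative is therefore zero, and it is constant on a ball. -/
theorem IsLocallySymmetric.eventually_curvature_eq (hG : G.IsLocallySymmetric)
    (he : IsHolChart M e) {z : ℂ} (hz : z ∈ e.target) :
    ∀ᶠ w in 𝓝 z, curvatureComponent (G.g e) w = curvatureComponent (G.g e) z := by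
  obtain ⟨r, hr, hball⟩ := Metric.nhds_basis_ball.mem_iff.1 (e.open_target.mem_nhds hz)
  have hsm (w : ℂ) (hw : w ∈ e.target) : ContDiffAt ℝ ∞ (curvatureComponent (G.g e)) w :=
    (G.smoothNear_curvature he hw).contDiffAt.congr_of_eventuallyEq
      (G.curvatureComponent_eventuallyEq he hw)
  have hder (w : ℂ) (hw : w ∈ e.target) : fderiv ℝ (curvatureComponent (G.g e)) w = 0 := by
    have h0 := G.g_ne_zero he hw
    have hk := (G.smoothNear_gInv he hw).contDiffAt.differentiableAt (by simp)
    have hS := (G.smoothNear_connection he hw).dzbar.contDiffAt.differentiableAt (by simp)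
    have e1 := hG e he w hw 0 1 0 0 0
    have e2 := hG e he w hw 1 1 0 0 0
    rw [covRiemann_zero, riemann_one_zero] at e1
    rw [covRiemann_one, riemann_one_zero] at e2
    have hkd := congrArg (germEval w) (G.derivation_gInvGerm he hw (germDz w))
    have hkd' := congrArg (germEval w) (G.derivation_gInvGerm he hw (germDzbar w))
    change dz (G.g e)⁻¹ w = -((G.g e w)⁻¹ * (G.g e w)⁻¹) * dz (G.g e) w at hkd
    change dzbar (G.g e)⁻¹ w = -((G.g e w)⁻¹ * (G.g e w)⁻¹) * dzbar (G.g e) w at hkd'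
    have d1 : dz (curvatureComponent (G.g e)) w = 0 := by
      rw [(G.curvatureComponent_eventuallyEq he hw).dz.self_of_nhds, dz_mul hk hS, hkd,
        Pi.inv_apply]
      linear_combination (G.g e w)⁻¹ * e1
    have d2 : dzbar (curvatureComponent (G.g e)) w = 0 := by
      rw [(G.curvatureComponent_eventuallyEq he hw).dzbar.self_of_nhds, dzbar_mul hk hS, hkd',
        Pi.inv_apply]
      linear_combination (G.g e w)⁻¹ * e2
    ext v
    rw [fderiv_apply_eq_wirtinger, d1, d2]
    simp
  filter_upwards [Metric.ball_mem_nhds z hr] with w hw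
  exact Metric.isOpen_ball.is_const_of_fderiv_eq_zero (convex_ball z r).isPreconnected
    (fun v hv => ((hsm v (hball hv)).differentiableAt (by simp)).differentiableWithinAt)
    (fun v hv => hder v (hball hv)) hw (Metric.mem_ball_self hr)

theorem IsLocallySymmetric.constantCurvature (hG : G.IsLocallySymmetric)
    (he : IsHolChart M e) {z : ℂ} (hz : z ∈ e.target) :
    ConstantCurvature (germDz z) (germDzbar z) (G.gGerm he hz) (G.gInvGerm he hz)
      (curvatureComponent (G.g e) z) where
  comm := germDz_germDzbar_comm
  mul_inv := G.gGerm_mul_gInvGerm he hz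
  curvature := by
    have hR : G.gInvGerm he hz * germDzbar z (G.gInvGerm he hz * germDz z (G.gGerm he hz)) =
        algebraMap ℂ _ (curvatureComponent (G.g e) z) := by
      refine (germ_eq_iff (G.smoothNear_curvature he hz) (smoothNear_const _ z)).2 ?_
      exact (G.curvatureComponent_eventuallyEq he hz).symm.trans (hG.eventually_curvature_eq he hz)
    rw [G.germDz_dzbar_log, Algebra.smul_def, ← hR]
    linear_combination -germDzbar z (G.gInvGerm he hz * germDz z (G.gGerm he hz)) *
      G.gGerm_mul_gInvGerm he hz

end KahlerMetric

/-! ### Change of coordinates -/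

theorem mem_target_of_mem_source {M : Type*} [TopologicalSpace M]
    {e e' : OpenPartialHomeomorph M ℂ} {z : ℂ} (hz : z ∈ (e.symm ≫ₕ e').source) :
    e' (e.symm z) ∈ e'.target := by
  rw [OpenPartialHomeomorph.trans_source] at hz
  exact e'.map_source hz.2

theorem differentiableAt_deriv_transition (he : IsHolChart M e) (he' : IsHolChart M e') {z : ℂ}
    (hz : z ∈ (e.symm ≫ₕ e').source) :
    DifferentiableAt ℂ (deriv fun w => e' (e.symm w)) z := by
  have h : DifferentiableOn ℂ (fun w => e' (e.symm w)) (e.symm ≫ₕ e').source := fun w hw =>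
    (differentiableAt_transition he he' hw).differentiableWithinAt
  exact (h.deriv (e.symm ≫ₕ e').open_source).differentiableAt
    ((e.symm ≫ₕ e').open_source.mem_nhds hz)

namespace KahlerMetric

variable (G)

theorem g_transition (he : IsHolChart M e) (he' : IsHolChart M e') {z : ℂ}
    (hz : z ∈ (e.symm ≫ₕ e').source) :
    G.g e z = G.g e' (e' (e.symm z)) * (deriv (fun w => e' (e.symm w)) z *
      (starRingEnd ℂ) (deriv (fun w => e' (e.symm w)) z)) := by
  rw [g, g, G.transform e e' he he' z hz, Complex.mul_conj, Complex.normSq_eq_norm_sq]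
  push_cast
  rfl

/-- A zero derivative would, by the transformation law, make the metric vanish at z. -/
theorem deriv_transition_ne_zero (G : KahlerMetric M) (he : IsHolChart M e) (he' : IsHolChart M e') {z : ℂ}
    (hz : z ∈ (e.symm ≫ₕ e').source) : deriv (fun w => e' (e.symm w)) z ≠ 0 := by
  intro h
  have h1 := G.g_transition he he' hz
  rw [h, zero_mul, mul_zero] at h1
  exact G.g_ne_zero he hz.1 h1

/-- With φ the coordinate change, Γ transforms to φ'·(Γ ∘ φ) + φ''/φ'. The inhomogeneous term is
holomorphic and disappears under ∂̄; the remaining factor |φ'|² cancels against the one in the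
metric. -/
theorem curvatureComponent_transition (he : IsHolChart M e) (he' : IsHolChart M e') {z : ℂ}
    (hz : z ∈ (e.symm ≫ₕ e').source) :
    curvatureComponent (G.g e) z = curvatureComponent (G.g e') (e' (e.symm z)) := by
  have hO := (e.symm ≫ₕ e').open_source
  set φ : ℂ → ℂ := fun w => e' (e.symm w) with hφ
  have hmem {w : ℂ} (hw : w ∈ (e.symm ≫ₕ e').source) : φ w ∈ e'.target :=
    mem_target_of_mem_source hw
  have hdφ {w : ℂ} (hw : w ∈ (e.symm ≫ₕ e').source) : DifferentiableAt ℂ φ w :=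
    differentiableAt_transition he he' hw
  have hddφ {w : ℂ} (hw : w ∈ (e.symm ≫ₕ e').source) : DifferentiableAt ℂ (deriv φ) w :=
    differentiableAt_deriv_transition he he' hw
  have hne {w : ℂ} (hw : w ∈ (e.symm ≫ₕ e').source) : deriv φ w ≠ 0 :=
    G.deriv_transition_ne_zero he he' hw
  have hconj {w : ℂ} (hw : w ∈ (e.symm ≫ₕ e').source) :
      DifferentiableAt ℝ (fun w => (starRingEnd ℂ) (deriv φ w)) w :=
    Complex.conjCLE.differentiable.differentiableAt.comp w ((hddφ hw).restrictScalars ℝ)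
  have hgφ {w : ℂ} (hw : w ∈ (e.symm ≫ₕ e').source) :
      DifferentiableAt ℝ (fun w => G.g e' (φ w)) w :=
    ((G.smoothNear_g he' (hmem hw)).contDiffAt.differentiableAt (by simp)).comp w
      ((hdφ hw).restrictScalars ℝ)
  have hconn : (G.g e)⁻¹ * dz (G.g e) =ᶠ[𝓝 z]
      (deriv φ * fun w => ((G.g e')⁻¹ * dz (G.g e')) (φ w)) + (deriv φ)⁻¹ * deriv (deriv φ) := by
    filter_upwards [hO.mem_nhds hz] with w hw
    have heq : G.g e =ᶠ[𝓝 w] (fun w => G.g e' (φ w)) *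
        (deriv φ * fun w => (starRingEnd ℂ) (deriv φ w)) := by
      filter_upwards [hO.mem_nhds hw] with v hv using G.g_transition he he' hv
    have hd2 : DifferentiableAt ℝ (deriv φ) w := (hddφ hw).restrictScalars ℝ
    have hcne : (starRingEnd ℂ) (deriv φ w) ≠ 0 := by simpa using hne hw
    have hgne := G.g_ne_zero he' (hmem hw)
    simp only [Pi.mul_apply, Pi.add_apply, Pi.inv_apply]
    rw [heq.dz.self_of_nhds, heq.self_of_nhds, dz_mul (hgφ hw) (hd2.mul (hconj hw)),
      dz_mul hd2 (hconj hw), dz_conj hd2, dzbar_eq_zero_of_differentiableAt (hddφ hw),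
      dz_comp ((G.smoothNear_g he' (hmem hw)).contDiffAt.differentiableAt (by simp)) (hdφ hw),
      dz_eq_deriv (hddφ hw)]
    simp only [Pi.mul_apply, map_zero, mul_zero, zero_add]
    have := hne hw
    field_simp
    ring
  have hd2 : DifferentiableAt ℝ (deriv φ) z := (hddφ hz).restrictScalars ℝ
  have hΓ : DifferentiableAt ℝ ((G.g e')⁻¹ * dz (G.g e')) (φ z) :=
    (G.smoothNear_connection he' (hmem hz)).contDiffAt.differentiableAt (by simp)
  have hΓφ : DifferentiableAt ℝ (fun w => ((G.g e')⁻¹ * dz (G.g e')) (φ w)) z :=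
    hΓ.comp z ((hdφ hz).restrictScalars ℝ)
  have hlast : DifferentiableAt ℂ ((deriv φ)⁻¹ * deriv (deriv φ)) z := by
    have h : DifferentiableOn ℂ (deriv φ) (e.symm ≫ₕ e').source := fun w hw =>
      (hddφ hw).differentiableWithinAt
    exact ((hddφ hz).inv (hne hz)).mul ((h.deriv hO).differentiableAt (hO.mem_nhds hz))
  rw [curvatureComponent_eq _ (G.g_ne_zero he hz.1),
    curvatureComponent_eq _ (G.g_ne_zero he' (hmem hz)), Pi.mul_apply, Pi.mul_apply,
    hconn.dzbar.self_of_nhds, dzbar_add (hd2.mul hΓφ) (hlast.restrictScalars ℝ),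
    dzbar_mul hd2 hΓφ, dzbar_comp hΓ (hdφ hz), dzbar_eq_zero_of_differentiableAt (hddφ hz),
    dzbar_eq_zero_of_differentiableAt hlast, Pi.inv_apply, Pi.inv_apply, G.g_transition he he' hz]
  have h1 := hne hz
  have h2 : (starRingEnd ℂ) (deriv φ z) ≠ 0 := by simpa using hne hz
  have h3 := G.g_ne_zero he' (hmem hz)
  simp only [hφ] at h1 h2 h3 ⊢
  field_simp
  ring

theorem smoothNear_iterate_metric {δ : (ℂ → ℂ) → ℂ → ℂ} (hδ : IsLocalDerivation δ)
    (he : IsHolChart M e) {X : ℂ → ℂ} (hX : ∀ z ∈ e.target, SmoothNear X z) (m : ℕ) :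
    ∀ z ∈ e.target, SmoothNear ((fun ψ w => (G.g e w)⁻¹ * δ ψ w)^[m] X) z := by
  induction m with
  | zero => exact hX
  | succ m ih =>
    intro z hz
    rw [Function.iterate_succ_apply']
    exact (G.smoothNear_gInv he hz).mul (hδ.smoothNear (ih z hz))

/-- The factor conj φ' from ∂̄ cancels in g⁻¹∂̄, leaving 1/φ'. This is holomorphic, so later
applications of ∂̄ pass it and the iterates pick up only a power of φ'. -/
theorem Dbar_iterate_transition (he : IsHolChart M e) (he' : IsHolChart M e') {X Y : ℂ → ℂ}
    (hY : ∀ z ∈ e'.target, SmoothNear Y z)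
    (hXY : ∀ z ∈ (e.symm ≫ₕ e').source, X z = Y (e' (e.symm z))) (m : ℕ) :
    ∀ z ∈ (e.symm ≫ₕ e').source, deriv (fun w => e' (e.symm w)) z ^ m * (G.Dbar e)^[m] X z =
      (G.Dbar e')^[m] Y (e' (e.symm z)) := by
  have hO := (e.symm ≫ₕ e').open_source
  induction m with
  | zero => simpa using hXY
  | succ m ih =>
    intro z hz
    have hd := differentiableAt_transition he he' hz
    have hdd := (differentiableAt_deriv_transition he he' hz).pow m
    have hne := G.deriv_transition_ne_zero he he' hz
    have hg := G.g_transition he he' hz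
    have hgne := G.g_ne_zero he' (mem_target_of_mem_source hz)
    have hYm : DifferentiableAt ℝ ((G.Dbar e')^[m] Y) (e' (e.symm z)) :=
      (G.smoothNear_iterate_metric isLocalDerivation_dzbar he' hY m _
        (mem_target_of_mem_source hz)).contDiffAt.differentiableAt (by simp)
    have heq : (G.Dbar e)^[m] X =ᶠ[𝓝 z] ((deriv fun w => e' (e.symm w)) ^ m)⁻¹ *
        fun w => (G.Dbar e')^[m] Y (e' (e.symm w)) := by
      filter_upwards [hO.mem_nhds hz] with w hw
      have hne := pow_ne_zero m (G.deriv_transition_ne_zero he he' hw)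
      rw [Pi.mul_apply, Pi.inv_apply, Pi.pow_apply, ← ih w hw]
      field_simp
    have hinv : DifferentiableAt ℂ ((deriv fun w => e' (e.symm w)) ^ m)⁻¹ z :=
      hdd.inv (pow_ne_zero m hne)
    have hYφ : DifferentiableAt ℝ (fun w => (G.Dbar e')^[m] Y (e' (e.symm w))) z :=
      hYm.comp z (hd.restrictScalars ℝ)
    rw [Function.iterate_succ_apply', Function.iterate_succ_apply', Dbar, Dbar,
      heq.dzbar.self_of_nhds,
      dzbar_mul (hinv.restrictScalars ℝ) hYφ,
      dzbar_eq_zero_of_differentiableAt hinv, dzbar_comp hYm hd, hg, Pi.inv_apply, Pi.pow_apply]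
    have hne' : (starRingEnd ℂ) (deriv (fun w => e' (e.symm w)) z) ≠ 0 := by simpa using hne
    field_simp
    ring

/-- The conjugate situation: the factor left over is antiholomorphic, hence constant for ∂. -/
theorem D_iterate_transition (he : IsHolChart M e) (he' : IsHolChart M e') {X Y : ℂ → ℂ}
    (hY : ∀ z ∈ e'.target, SmoothNear Y z)
    (hXY : ∀ z ∈ (e.symm ≫ₕ e').source, X z = Y (e' (e.symm z))) (m : ℕ) :
    ∀ z ∈ (e.symm ≫ₕ e').source,
      (starRingEnd ℂ) (deriv (fun w => e' (e.symm w)) z) ^ m * (G.D e)^[m] X z =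
        (G.D e')^[m] Y (e' (e.symm z)) := by
  have hO := (e.symm ≫ₕ e').open_source
  induction m with
  | zero => simpa using hXY
  | succ m ih =>
    intro z hz
    have hd := differentiableAt_transition he he' hz
    have hdd := (differentiableAt_deriv_transition he he' hz).pow m
    have hne := G.deriv_transition_ne_zero he he' hz
    have hg := G.g_transition he he' hz
    have hgne := G.g_ne_zero he' (mem_target_of_mem_source hz)
    have hYm : DifferentiableAt ℝ ((G.D e')^[m] Y) (e' (e.symm z)) :=
      (G.smoothNear_iterate_metric isLocalDerivation_dz he' hY m _
        (mem_target_of_mem_source hz)).contDiffAt.differentiableAt (by simp)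
    have heq : (G.D e)^[m] X =ᶠ[𝓝 z]
        (fun w => (starRingEnd ℂ) (((deriv fun w => e' (e.symm w)) ^ m)⁻¹ w)) *
          fun w => (G.D e')^[m] Y (e' (e.symm w)) := by
      filter_upwards [hO.mem_nhds hz] with w hw
      have hne : (starRingEnd ℂ) (deriv (fun w => e' (e.symm w)) w) ≠ 0 := by
        simpa using G.deriv_transition_ne_zero he he' hw
      rw [Pi.mul_apply, Pi.inv_apply, Pi.pow_apply, ← ih w hw, map_inv₀, map_pow]
      field_simp
    have hinv : DifferentiableAt ℂ ((deriv fun w => e' (e.symm w)) ^ m)⁻¹ z :=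
      hdd.inv (pow_ne_zero m hne)
    have hYφ : DifferentiableAt ℝ (fun w => (G.D e')^[m] Y (e' (e.symm w))) z :=
      hYm.comp z (hd.restrictScalars ℝ)
    have hcinv : DifferentiableAt ℝ
        (fun w => (starRingEnd ℂ) (((deriv fun w => e' (e.symm w)) ^ m)⁻¹ w)) z :=
      Complex.conjCLE.differentiable.differentiableAt.comp z (hinv.restrictScalars ℝ)
    rw [Function.iterate_succ_apply', Function.iterate_succ_apply', D, D,
      heq.dz.self_of_nhds,
      dz_mul hcinv hYφ,
      dz_conj (hinv.restrictScalars ℝ), dzbar_eq_zero_of_differentiableAt hinv, dz_comp hYm hd, hg,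
      Pi.inv_apply, Pi.pow_apply, map_inv₀, map_pow]
    have hne' : (starRingEnd ℂ) (deriv (fun w => e' (e.symm w)) z) ≠ 0 := by simpa using hne
    simp only [map_zero, mul_zero, add_zero]
    field_simp
    ring

/-- The summand `h ^ m (D̄ ^ m f) (D ^ m g)` of the star product does not depend on the chart. -/
theorem term_transition (he : IsHolChart M e) (he' : IsHolChart M e') (f g : SmoothFun M) (m : ℕ)
    {z : ℂ} (hz : z ∈ (e.symm ≫ₕ e').source) :
    G.g e z ^ m * (G.Dbar e)^[m] (inChart e f) z * (G.D e)^[m] (inChart e g) z =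
      G.g e' (e' (e.symm z)) ^ m * (G.Dbar e')^[m] (inChart e' f) (e' (e.symm z)) *
        (G.D e')^[m] (inChart e' g) (e' (e.symm z)) := by
  have hchart (f : SmoothFun M) (z : ℂ) (hz : z ∈ (e.symm ≫ₕ e').source) :
      inChart e f z = inChart e' f (e' (e.symm z)) := by
    rw [OpenPartialHomeomorph.trans_source] at hz
    rw [inChart, inChart, e'.left_inv hz.2]
  rw [← G.Dbar_iterate_transition he he' (fun z hz => smoothNear_inChart he' hz f) (hchart f) m z hz,
    ← G.D_iterate_transition he he' (fun z hz => smoothNear_inChart he' hz g) (hchart g) m z hz,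
    G.g_transition he he' hz]
  ring

end KahlerMetric

end Curvature

/-! ### Existence of the star product with separation of variables -/

section Existence

open Filter Topology

variable {M : Type*} [TopologicalSpace M] [ChartedSpace ℂ M] {G : KahlerMetric M}
  {e e' : OpenPartialHomeomorph M ℂ}

theorem germ_pow {z : ℂ} {φ : ℂ → ℂ} (hφ : SmoothNear φ z) (m : ℕ) :
    ∃ h' : SmoothNear (φ ^ m) z, germ φ hφ ^ m = germ (φ ^ m) h' := by
  induction m with
  | zero => exact ⟨by rw [pow_zero]; exact smoothNear_const 1 z, by simp only [pow_zero]; rfl⟩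
  | succ m ih =>
    obtain ⟨h', h⟩ := ih
    refine ⟨by rw [pow_succ]; exact h'.mul hφ, ?_⟩
    rw [pow_succ, h, germ_mul, germ_eq_iff, pow_succ]

theorem mem_transition_chartAt {z : ℂ} (hz : z ∈ e.target) :
    z ∈ (e.symm ≫ₕ chartAt ℂ (e.symm z)).source := by
  rw [OpenPartialHomeomorph.trans_source]
  exact ⟨hz, mem_chart_source ℂ _⟩

namespace KahlerMetric

theorem iterate_metric_germ (G : KahlerMetric M) {δ : (ℂ → ℂ) → ℂ → ℂ} (hδ : IsLocalDerivation δ)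
    (he : IsHolChart M e) {X : ℂ → ℂ} (hX : ∀ z ∈ e.target, SmoothNear X z) (m : ℕ) {z : ℂ}
    (hz : z ∈ e.target) :
    (G.gInvGerm he hz • germDerivation z hδ)^[m] (germ X (hX z hz)) =
      germ ((fun ψ w => (G.g e w)⁻¹ * δ ψ w)^[m] X)
        (G.smoothNear_iterate_metric hδ he hX m z hz) := by
  induction m with
  | zero => rfl
  | succ m ih =>
    rw [Function.iterate_succ_apply', ih, Derivation.smul_apply, germDerivation_germ, smul_eq_mul,
      gInvGerm, germ_mul, germ_eq_iff, Function.iterate_succ_apply']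
    rfl

variable (G)

/-- The `n`-th operator of the closed formula in a chart, with curvature component `R`. -/
def localStar (e : OpenPartialHomeomorph M ℂ) (R : ℂ) (n : ℕ) (f g : SmoothFun M) : ℂ → ℂ :=
  ∑ m ∈ Finset.range (n + 1), fun w => tau R m n *
    (G.g e w ^ m * (G.Dbar e)^[m] (inChart e f) w * (G.D e)^[m] (inChart e g) w)

theorem localStar_apply (e : OpenPartialHomeomorph M ℂ) (R : ℂ) (n : ℕ) (f g : SmoothFun M)
    (w : ℂ) : G.localStar e R n f g w = ∑ m ∈ Finset.range (n + 1), tau R m n *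
      (G.g e w ^ m * (G.Dbar e)^[m] (inChart e f) w * (G.D e)^[m] (inChart e g) w) :=
  Finset.sum_apply _ _ _

/-- The bridge between the algebra of germs and the concrete formula: algebraic identities for
`starTerm` become statements on functions. -/
theorem exists_starTerm_eq_germ (he : IsHolChart M e) {z : ℂ} (hz : z ∈ e.target) (R : ℂ) (n : ℕ)
    (f g : SmoothFun M) :
    ∃ h : SmoothNear (G.localStar e R n f g) z,
      starTerm (germDz z) (germDzbar z) (G.gGerm he hz) (G.gInvGerm he hz) R n
        (restrictGerm he hz f) (restrictGerm he hz g) = germ (G.localStar e R n f g) h := by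
  have hterm (m : ℕ) :
      ∃ h : SmoothNear (fun w => tau R m n *
        (G.g e w ^ m * (G.Dbar e)^[m] (inChart e f) w * (G.D e)^[m] (inChart e g) w)) z,
      tau R m n • (G.gGerm he hz ^ m * (G.gInvGerm he hz • germDzbar z)^[m] (restrictGerm he hz f) *
        (G.gInvGerm he hz • germDz z)^[m] (restrictGerm he hz g)) = germ _ h := by
    obtain ⟨hp, hpow⟩ := germ_pow (G.smoothNear_g he hz) m
    refine ⟨?_, ?_⟩
    · exact (smoothNear_const _ z).mul ((hp.mul (G.smoothNear_iterate_metric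
        isLocalDerivation_dzbar he (fun z hz => smoothNear_inChart he hz f) m z hz)).mul
        (G.smoothNear_iterate_metric isLocalDerivation_dz he
          (fun z hz => smoothNear_inChart he hz g) m z hz))
    · rw [restrictGerm_apply, restrictGerm_apply,
        G.iterate_metric_germ isLocalDerivation_dzbar he (fun z hz => smoothNear_inChart he hz f),
        G.iterate_metric_germ isLocalDerivation_dz he (fun z hz => smoothNear_inChart he hz g),
        gGerm, hpow, germ_mul, germ_mul, smul_germ]
      rfl
  choose h hh using hterm
  obtain ⟨h', hsum⟩ := germ_sum (Finset.range (n + 1)) h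
  refine ⟨h', ?_⟩
  rw [starTerm_apply, Finset.sum_congr rfl fun m _ => hh m, hsum]
  rfl

theorem germEval_starTerm (he : IsHolChart M e) {z : ℂ} (hz : z ∈ e.target) (R : ℂ) (n : ℕ)
    (f g : SmoothFun M) :
    germEval z (starTerm (germDz z) (germDzbar z) (G.gGerm he hz) (G.gInvGerm he hz) R n
        (restrictGerm he hz f) (restrictGerm he hz g)) = G.localStar e R n f g z := by
  obtain ⟨h, heq⟩ := G.exists_starTerm_eq_germ he hz R n f g
  rw [heq, germEval_germ]

theorem localStar_transition (he : IsHolChart M e) (he' : IsHolChart M e') (R : ℂ) (n : ℕ)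
    (f g : SmoothFun M) {z : ℂ} (hz : z ∈ (e.symm ≫ₕ e').source) :
    G.localStar e R n f g z = G.localStar e' R n f g (e' (e.symm z)) := by
  rw [localStar_apply, localStar_apply]
  refine Finset.sum_congr rfl fun m _ => ?_
  rw [G.term_transition he he' f g m hz]

/-- The curvature component as a function on `M`. -/
def curvatureFun (p : M) : ℝ := (curvatureComponent (G.g (chartAt ℂ p)) (chartAt ℂ p p)).re

variable [IsManifold 𝓘(ℂ) ω M]

theorem curvatureComponent_eq_curvatureFun (he : IsHolChart M e) {z : ℂ} (hz : z ∈ e.target) :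
    curvatureComponent (G.g e) z = (G.curvatureFun (e.symm z) : ℂ) := by
  have h := G.curvatureComponent_transition he (isHolChart_chartAt (e.symm z))
    (mem_transition_chartAt hz)
  rw [curvatureFun, ← h]
  exact (Complex.conj_eq_iff_re.1 (G.conj_curvatureComponent he hz)).symm

variable {G}

theorem IsLocallySymmetric.eventually_curvatureFun_eq (hG : G.IsLocallySymmetric)
    (he : IsHolChart M e) {z : ℂ} (hz : z ∈ e.target) :
    ∀ᶠ w in 𝓝 z, (G.curvatureFun (e.symm w) : ℂ) = G.curvatureFun (e.symm z) := by
  filter_upwards [hG.eventually_curvature_eq he hz, e.open_target.mem_nhds hz] with w hw hwe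
  rw [← G.curvatureComponent_eq_curvatureFun he hwe, hw, G.curvatureComponent_eq_curvatureFun he hz]

theorem IsLocallySymmetric.isLocallyConstant (hG : G.IsLocallySymmetric) :
    IsLocallyConstant G.curvatureFun := by
  rw [IsLocallyConstant.iff_eventually_eq]
  intro p
  have he := isHolChart_chartAt p
  have h := (chartAt ℂ p).continuousAt (mem_chart_source ℂ p) |>.eventually
    (hG.eventually_curvatureFun_eq he (mem_chart_target ℂ p))
  filter_upwards [h, (chartAt ℂ p).open_source.mem_nhds (mem_chart_source ℂ p)] with q hq hqs
  rw [(chartAt ℂ p).left_inv hqs, (chartAt ℂ p).left_inv (mem_chart_source ℂ p)] at hq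
  exact_mod_cast hq

variable (G)

/-- The value at a point of the `n`-th operator of the closed formula. -/
def starValue (n : ℕ) (f g : SmoothFun M) (p : M) : ℂ :=
  G.localStar (chartAt ℂ p) (G.curvatureFun p) n f g (chartAt ℂ p p)

theorem starValue_chart (he : IsHolChart M e) (n : ℕ) (f g : SmoothFun M) {z : ℂ}
    (hz : z ∈ e.target) :
    G.starValue n f g (e.symm z) = G.localStar e (G.curvatureFun (e.symm z)) n f g z :=
  (G.localStar_transition he (isHolChart_chartAt _) _ n f g (mem_transition_chartAt hz)).symm

variable {G}

/-- `starValue` uses a chart and a curvature value that vary with the point. Chart independence and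
local constancy of R allow both to be frozen near z. -/
theorem IsLocallySymmetric.starValue_eventuallyEq (hG : G.IsLocallySymmetric)
    (he : IsHolChart M e) (n : ℕ) (f g : SmoothFun M) {z : ℂ} (hz : z ∈ e.target) :
    (fun w => G.starValue n f g (e.symm w)) =ᶠ[𝓝 z]
      G.localStar e (curvatureComponent (G.g e) z) n f g := by
  filter_upwards [hG.eventually_curvatureFun_eq he hz, e.open_target.mem_nhds hz] with w hw hwe
  rw [G.starValue_chart he n f g hwe, hw, G.curvatureComponent_eq_curvatureFun he hz]

theorem IsLocallySymmetric.contMDiff_starValue (hG : G.IsLocallySymmetric) (n : ℕ)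
    (f g : SmoothFun M) : ContMDiff 𝓘(ℝ, ℂ) 𝓘(ℝ, ℂ) ∞ (G.starValue n f g) := by
  intro p
  have he := isHolChart_chartAt p
  have hz := mem_chart_target ℂ p
  rw [← (chartAt ℂ p).left_inv (mem_chart_source ℂ p), contMDiffAt_iff_contDiffAt_chart he hz]
  obtain ⟨h, -⟩ := G.exists_starTerm_eq_germ he hz
    (curvatureComponent (G.g (chartAt ℂ p)) (chartAt ℂ p p)) n f g
  exact h.contDiffAt.congr_of_eventuallyEq (hG.starValue_eventuallyEq he n f g hz)

/-- The bidifferential operators of the closed formula. -/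
def IsLocallySymmetric.star (hG : G.IsLocallySymmetric) (n : ℕ) :
    SmoothFun M →ₗ[ℂ] SmoothFun M →ₗ[ℂ] SmoothFun M :=
  have key (f g : SmoothFun M) (p : M) := G.germEval_starTerm (isHolChart_chartAt p)
    (mem_chart_target ℂ p) (G.curvatureFun p) n f g
  LinearMap.mk₂ ℂ (fun f g => ⟨G.starValue n f g, hG.contMDiff_starValue n f g⟩)
    (fun f f' g => Subtype.ext (funext fun p => by
      change G.starValue n (f + f') g p = G.starValue n f g p + G.starValue n f' g p
      simp only [starValue, ← key, map_add, LinearMap.add_apply]))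
    (fun c f g => Subtype.ext (funext fun p => by
      change G.starValue n (c • f) g p = c • G.starValue n f g p
      simp only [starValue, ← key, map_smul, LinearMap.smul_apply]))
    (fun f g g' => Subtype.ext (funext fun p => by
      change G.starValue n f (g + g') p = G.starValue n f g p + G.starValue n f g' p
      simp only [starValue, ← key, map_add]))
    (fun c f g => Subtype.ext (funext fun p => by
      change G.starValue n f (c • g) p = c • G.starValue n f g p
      simp only [starValue, ← key, map_smul]))

namespace IsLocallySymmetric

variable (hG : G.IsLocallySymmetric)
include hG

theorem inChart_star (he : IsHolChart M e) (n : ℕ) (f g : SmoothFun M) {z : ℂ}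
    (hz : z ∈ e.target) :
    inChart e (hG.star n f g) z = G.localStar e (G.curvatureFun (e.symm z)) n f g z :=
  G.starValue_chart he n f g hz

theorem restrictGerm_star (he : IsHolChart M e) {z : ℂ} (hz : z ∈ e.target) (n : ℕ)
    (f g : SmoothFun M) :
    restrictGerm he hz (hG.star n f g) =
      starTerm (germDz z) (germDzbar z) (G.gGerm he hz) (G.gInvGerm he hz)
        (curvatureComponent (G.g e) z) n (restrictGerm he hz f) (restrictGerm he hz g) := by
  obtain ⟨h, heq⟩ := G.exists_starTerm_eq_germ he hz (curvatureComponent (G.g e) z) n f g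
  rw [heq, restrictGerm_apply, germ_eq_iff]
  exact hG.starValue_eventuallyEq he n f g hz

theorem map_restrictGerm_star (he : IsHolChart M e) {z : ℂ} (hz : z ∈ e.target)
    (f g : (SmoothFun M)⟦X⟧) :
    PowerSeries.map (restrictGerm he hz : SmoothFun M →+* SmoothGerm z) (starProd hG.star f g) =
      formalProd (starTerm (germDz z) (germDzbar z) (G.gGerm he hz) (G.gInvGerm he hz)
        (curvatureComponent (G.g e) z)) (PowerSeries.map (restrictGerm he hz : _ →+* _) f)
        (PowerSeries.map (restrictGerm he hz : _ →+* _) g) :=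
  map_formalProd _ (restrictGerm he hz) _ (hG.restrictGerm_star he hz) f g

end IsLocallySymmetric

end KahlerMetric

/-! ### Checking identities of formal power series on germs. -/

theorem inChart_coeff (he : IsHolChart M e) {z : ℂ} (hz : z ∈ e.target) (n : ℕ)
    (F : (SmoothFun M)⟦X⟧) :
    inChart e (PowerSeries.coeff n F) z = germEval z (PowerSeries.coeff n
      (PowerSeries.map (restrictGerm he hz : SmoothFun M →+* SmoothGerm z) F)) := by
  rw [PowerSeries.coeff_map]
  rfl

theorem smoothSeries_ext [IsManifold 𝓘(ℂ) ω M] {F F' : (SmoothFun M)⟦X⟧}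
    (h : ∀ e (he : IsHolChart M e) z (hz : z ∈ e.target) n,
      germEval z (PowerSeries.coeff n
        (PowerSeries.map (restrictGerm he hz : SmoothFun M →+* SmoothGerm z) F)) =
      germEval z (PowerSeries.coeff n
        (PowerSeries.map (restrictGerm he hz : SmoothFun M →+* SmoothGerm z) F'))) : F = F' := by
  ext1 n
  refine smoothFun_ext fun e he z hz => ?_
  rw [inChart_coeff he hz, inChart_coeff he hz, h e he z hz n]

theorem evalAt_congr (he : IsHolChart M e) {p : M} (hp : p ∈ e.source) {F F' : (SmoothFun M)⟦X⟧}
    (h : PowerSeries.map (restrictGerm he (e.map_source hp) : SmoothFun M →+* SmoothGerm (e p)) F =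
      PowerSeries.map (restrictGerm he (e.map_source hp) : SmoothFun M →+* SmoothGerm (e p)) F') :
    evalAt p F = evalAt p F' := by
  rw [evalAt_eq_iff]
  intro n
  have := inChart_coeff he (e.map_source hp) n F
  rw [h, ← inChart_coeff he (e.map_source hp) n F', inChart, inChart, e.left_inv hp] at this
  exact this

theorem germDzbar_eq_zero_of_holomorphic (he : IsHolChart M e) {U : Set M} {a : SmoothFun M}
    (hU : IsOpen U) (ha : MDifferentiableOn 𝓘(ℂ) 𝓘(ℂ) (a : M → ℂ) U) {z : ℂ} (hz : z ∈ e.target)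
    (hzU : e.symm z ∈ U) : germDzbar z (restrictGerm he hz a) = 0 := by
  rw [restrictGerm_apply, germDerivation_germ]
  refine (germ_eq_iff (smoothNear_inChart he hz a).dzbar (smoothNear_const 0 z)).2 ?_
  filter_upwards [e.open_target.mem_nhds hz, (e.continuousAt_symm hz).eventually (hU.mem_nhds hzU)]
    with w hw hwU
  exact dzbar_eq_zero_of_differentiableAt ((mdifferentiableAt_iff_differentiableAt_chart he hw).1
    (ha.mdifferentiableAt (hU.mem_nhds hwU)))

theorem germDz_eq_zero_of_antiholomorphic (he : IsHolChart M e) {U : Set M} {b : SmoothFun M}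
    (hU : IsOpen U)
    (hb : MDifferentiableOn 𝓘(ℂ) 𝓘(ℂ) (fun p => (starRingEnd ℂ) ((b : M → ℂ) p)) U) {z : ℂ}
    (hz : z ∈ e.target) (hzU : e.symm z ∈ U) : germDz z (restrictGerm he hz b) = 0 := by
  rw [restrictGerm_apply, germDerivation_germ]
  refine (germ_eq_iff (smoothNear_inChart he hz b).dz (smoothNear_const 0 z)).2 ?_
  filter_upwards [e.open_target.mem_nhds hz, (e.continuousAt_symm hz).eventually (hU.mem_nhds hzU)]
    with w hw hwU
  have h := dzbar_eq_zero_of_differentiableAt ((mdifferentiableAt_iff_differentiableAt_chart he hw).1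
    (hb.mdifferentiableAt (hU.mem_nhds hwU)))
  have hd : DifferentiableAt ℝ (inChart e b) w :=
    (smoothNear_inChart he hw b).contDiffAt.differentiableAt (by simp)
  rw [show (fun w => (starRingEnd ℂ) ((b : M → ℂ) (e.symm w))) =
    fun w => (starRingEnd ℂ) (inChart e b w) from rfl, dzbar_conj hd] at h
  simpa using h

/-- An iterate of `g^{1 1̄} δ` is a differential operator in `δ`. -/
theorem KahlerMetric.exists_iterate_metric_eq (G : KahlerMetric M) {δ : (ℂ → ℂ) → ℂ → ℂ}
    (hδ : IsLocalDerivation δ) (he : IsHolChart M e) (m : ℕ) :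
    ∃ α : ℕ → ℂ → ℂ, (∀ k, ∀ z ∈ e.target, SmoothNear (α k) z) ∧ (∀ k, m < k → α k = fun _ => 0) ∧
      ∀ X : ℂ → ℂ, (∀ z ∈ e.target, SmoothNear X z) → ∀ z ∈ e.target,
        (fun ψ w => (G.g e w)⁻¹ * δ ψ w)^[m] X z =
          ∑ k ∈ Finset.range (m + 1), α k z * δ^[k] X z := by
  induction m with
  | zero =>
    refine ⟨fun k _ => if k = 0 then 1 else 0, fun k z _ => smoothNear_const _ z, fun k hk => ?_,
      fun X _ z _ => by simp⟩
    simp [hk.ne']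
  | succ m ih =>
    obtain ⟨α, hα, hα0, h⟩ := ih
    -- Leibniz: δ applied to α_k δ^k X keeps the order with coefficient δα_k or raises it by one
    -- with coefficient α_k. Nothing is shifted into order zero, hence the case k = 0.
    refine ⟨fun k => (G.g e)⁻¹ * (δ (α k) + if k = 0 then (fun _ => 0) else α (k - 1)),
      fun k z hz => ?_, fun k hk => ?_, fun X hX z hz => ?_⟩
    · refine (G.smoothNear_gInv he hz).mul ((hδ.smoothNear (hα k z hz)).add ?_)
      split_ifs
      exacts [smoothNear_const 0 z, hα _ z hz]
    · dsimp only
      rw [hα0 k (by omega), hα0 (k - 1) (by omega), ite_self]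
      funext w
      simp [hδ.const]
    · have heq : (fun ψ w => (G.g e w)⁻¹ * δ ψ w)^[m] X =ᶠ[𝓝 z]
          ∑ k ∈ Finset.range (m + 1), α k * δ^[k] X := by
        filter_upwards [e.open_target.mem_nhds hz] with w hw
        rw [h X hX w hw, Finset.sum_apply]
        rfl
      have hd {φ : ℂ → ℂ} (hφ : SmoothNear φ z) : DifferentiableAt ℝ φ z :=
        hφ.contDiffAt.differentiableAt (by simp)
      rw [Function.iterate_succ_apply', (hδ.congr heq).self_of_nhds, hδ.sum _ fun k _ =>
        (hd (hα k z hz)).mul (hd (hδ.iterate_smoothNear (hX z hz) k)), Finset.sum_congr rfl fun k _ =>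
        hδ.mul (hd (hα k z hz)) (hd (hδ.iterate_smoothNear (hX z hz) k)), Finset.sum_add_distrib]
      have h1 : ∑ k ∈ Finset.range (m + 1 + 1), (δ (α k) z) * δ^[k] X z =
          ∑ k ∈ Finset.range (m + 1), δ^[k] X z * δ (α k) z := by
        rw [Finset.sum_range_succ, hα0 (m + 1) (by omega), hδ.const, zero_mul, add_zero]
        exact Finset.sum_congr rfl fun k _ => mul_comm _ _
      have h2 : ∑ k ∈ Finset.range (m + 1 + 1),
          (if k = 0 then (fun _ => 0) else α (k - 1) : ℂ → ℂ) z * δ^[k] X z =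
          ∑ k ∈ Finset.range (m + 1), α k z * δ (δ^[k] X) z := by
        rw [Finset.sum_range_succ']
        simp [Function.iterate_succ_apply']
      rw [← h1, ← h2, add_comm, ← Finset.sum_add_distrib, Finset.mul_sum]
      refine Finset.sum_congr rfl fun k _ => ?_
      simp only [Pi.mul_apply, Pi.inv_apply, Pi.add_apply]
      ring

theorem KahlerMetric.IsLocallySymmetric.isBidifferential_star [IsManifold 𝓘(ℂ) ω M]
    (hG : G.IsLocallySymmetric) (n : ℕ) : IsBidifferential (hG.star n) := by
  refine ⟨n, fun e he => ?_⟩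
  choose α hα hα0 h using fun m => G.exists_iterate_metric_eq isLocalDerivation_dz he m
  choose β hβ hβ0 h' using fun m => G.exists_iterate_metric_eq isLocalDerivation_dzbar he m
  have hext {m : ℕ} (hm : m ∈ Finset.range (n + 1)) {γ : ℕ → ℂ → ℂ}
      (hγ : ∀ k, m < k → γ k = fun _ => 0) (z : ℂ) (t : ℕ → ℂ) :
      ∑ k ∈ Finset.range (m + 1), γ k z * t k = ∑ k ∈ Finset.range (n + 1), γ k z * t k := by
    rw [Finset.mem_range] at hm
    refine Finset.sum_subset (Finset.range_subset_range.2 hm) fun k _ hk => ?_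
    rw [hγ k (by simpa using hk), zero_mul]
  -- Only ∂̄ falls on the first argument and only ∂ on the second, so coefficients with i ≠ 0 or l ≠
  -- 0 are zero.
  refine ⟨fun i j k l => if i = 0 ∧ l = 0 then ∑ m ∈ Finset.range (n + 1),
    (fun w => tau (curvatureComponent (G.g e) w) m n) * G.g e ^ m * β m j * α m k else fun _ => 0,
    fun i j k l => ?_, fun f g z hz => ?_⟩
  · dsimp only
    split_ifs
    · intro z hz
      refine ContDiffAt.contDiffWithinAt ?_
      have hs (m : ℕ) : ContDiffAt ℝ ∞
          ((fun w => tau (curvatureComponent (G.g e) w) m n) * G.g e ^ m * β m j * α m k) z := by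
        refine ((ContDiffAt.mul ?_ ((G.smoothNear_g he hz).contDiffAt.pow m)).mul
          (hβ m j z hz).contDiffAt).mul (hα m k z hz).contDiffAt
        -- The coefficient depends on the point through R, which is locally constant, so it is
        -- locally a constant.
        refine (contDiffAt_const (c := tau (curvatureComponent (G.g e) z) m n)).congr_of_eventuallyEq
          ?_
        filter_upwards [hG.eventually_curvature_eq he hz] with w hw
        rw [hw]
      rw [show (∑ m ∈ Finset.range (n + 1), (fun w => tau (curvatureComponent (G.g e) w) m n) *
        G.g e ^ m * β m j * α m k) = fun w => ∑ m ∈ Finset.range (n + 1),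
          ((fun w => tau (curvatureComponent (G.g e) w) m n) * G.g e ^ m * β m j * α m k) w from
          funext fun w => Finset.sum_apply _ _ _]
      exact ContDiffAt.sum fun m _ => hs m
    · exact contDiffOn_const
  · rw [hG.inChart_star he n f g hz, G.localStar_apply, ← G.curvatureComponent_eq_curvatureFun he hz]
    have hD (m : ℕ) (hm : m ∈ Finset.range (n + 1)) : (G.D e)^[m] (inChart e g) z =
        ∑ k ∈ Finset.range (n + 1), α m k z * dz^[k] (inChart e g) z := by
      rw [← hext hm (hα0 m) z]
      exact h m (inChart e g) (fun z hz => smoothNear_inChart he hz g) z hz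
    have hDbar (m : ℕ) (hm : m ∈ Finset.range (n + 1)) : (G.Dbar e)^[m] (inChart e f) z =
        ∑ k ∈ Finset.range (n + 1), β m k z * dzbar^[k] (inChart e f) z := by
      rw [← hext hm (hβ0 m) z]
      exact h' m (inChart e f) (fun z hz => smoothNear_inChart he hz f) z hz
    symm
    rw [Finset.sum_eq_single 0 (fun i _ hi => by simp [hi]) (by simp)]
    have hin (j k : ℕ) : ∑ l ∈ Finset.range (n + 1), (if (0 : ℕ) = 0 ∧ l = 0 then
        ∑ m ∈ Finset.range (n + 1), (fun w => tau (curvatureComponent (G.g e) w) m n) *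
          G.g e ^ m * β m j * α m k else fun _ => 0 : ℂ → ℂ) z *
        dz^[0] (dzbar^[j] (inChart e f)) z * dz^[k] (dzbar^[l] (inChart e g)) z =
        ∑ m ∈ Finset.range (n + 1), tau (curvatureComponent (G.g e) z) m n * (G.g e z ^ m *
          (β m j z * dzbar^[j] (inChart e f) z) * (α m k z * dz^[k] (inChart e g) z)) := by
      rw [Finset.sum_eq_single 0 (fun l _ hl => by simp [hl]) (by simp)]
      simp only [true_and, if_true, Finset.sum_apply, Pi.mul_apply, Pi.pow_apply,
        Function.iterate_zero, id, Finset.sum_mul]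
      exact Finset.sum_congr rfl fun m _ => by ring
    refine (Finset.sum_congr rfl fun j _ => Finset.sum_congr rfl fun k _ => hin j k).trans ?_
    rw [Finset.sum_congr rfl fun j _ => Finset.sum_comm, Finset.sum_comm]
    refine Finset.sum_congr rfl fun m hm => ?_
    rw [hD m hm, hDbar m hm, mul_assoc, Finset.sum_mul_sum, Finset.mul_sum, Finset.mul_sum]
    refine Finset.sum_congr rfl fun j _ => ?_
    rw [Finset.mul_sum, Finset.mul_sum]
    exact Finset.sum_congr rfl fun k _ => by ring

/-- The closed formula defines a star product with separation of variables. -/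
theorem KahlerMetric.IsLocallySymmetric.isStarProduct_star [IsManifold 𝓘(ℂ) ω M]
    (hG : G.IsLocallySymmetric) : IsStarProductWithSeparation G hG.star where
  assoc f g h := by
    refine smoothSeries_ext fun e he z hz n => ?_
    obtain ⟨V, Φ, hV, hzV, hVe, hΦ, hg⟩ := G.exists_potential he hz
    have hd := germ_potential_adapted he hV hVe hΦ hg hzV
    have H := (hG.constantCurvature he hz).associator_mem_vanishing (ev := germEval z) hd
      (germDz_germConj z) (germDzbar_germConj z)
      (PowerSeries.map (restrictGerm he hz : _ →+* _) f)
      (PowerSeries.map (restrictGerm he hz : _ →+* _) g)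
      (PowerSeries.map (restrictGerm he hz : _ →+* _) h) n 1
    rw [mem_vanishing_succ, map_sub, map_sub, sub_eq_zero] at H
    simp only [hG.map_restrictGerm_star]
    exact H.1.symm
  bidifferential := hG.isBidifferential_star
  zero_eq f g := by
    refine smoothFun_ext fun e he z hz => ?_
    rw [hG.inChart_star he 0 f g hz, G.localStar_apply]
    simp [tau_zero_left]
    rfl
  poisson e he f g z hz := by
    -- At order ħ only m = 1 contributes, since `tau R 0 1 = 0` and `tau R 1 1 = 1`.
    have h1 (f g : SmoothFun M) : inChart e (hG.star 1 f g) z =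
        (G.g e z)⁻¹ * (dzbar (inChart e f) z * dz (inChart e g) z) := by
      rw [hG.inChart_star he 1 f g hz, G.localStar_apply]
      have := G.g_ne_zero he hz
      simp [Finset.sum_range_succ, tau_zero_left, tau_one_one, KahlerMetric.D, KahlerMetric.Dbar]
      field_simp
    change inChart e (hG.star 1 f g) z - inChart e (hG.star 1 g f) z = _
    rw [h1, h1]
    ring
  one_star f := by
    refine smoothSeries_ext fun e he z hz n => ?_
    rw [hG.map_restrictGerm_star, map_one, ← map_one PowerSeries.C,
      const_formalProd (Derivation.map_one_eq_zero _), map_one, one_mul]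
  star_one f := by
    refine smoothSeries_ext fun e he z hz n => ?_
    rw [hG.map_restrictGerm_star, map_one, ← map_one PowerSeries.C,
      formalProd_const _ (Derivation.map_one_eq_zero _), map_one, mul_one]
  holomorphic U a hU ha f p hp := by
    have he := isHolChart_chartAt p
    refine evalAt_congr he (mem_chart_source ℂ p) ?_
    rw [hG.map_restrictGerm_star, map_mul, PowerSeries.map_C, const_formalProd]
    exact germDzbar_eq_zero_of_holomorphic he hU ha (mem_chart_target ℂ p)
      (by rwa [(chartAt ℂ p).left_inv (mem_chart_source ℂ p)])
  antiholomorphic U b hU hb f p hp := by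
    have he := isHolChart_chartAt p
    refine evalAt_congr he (mem_chart_source ℂ p) ?_
    rw [hG.map_restrictGerm_star, map_mul, PowerSeries.map_C, formalProd_const]
    exact germDz_eq_zero_of_antiholomorphic he hU hb (mem_chart_target ℂ p)
      (by rwa [(chartAt ℂ p).left_inv (mem_chart_source ℂ p)])
  commutes e he V Φ hV hVe hΦ hg f u v w hv hw n z hz := by
    have hd := germ_potential_adapted he hV hVe hΦ hg hz
    set y := germ _ (smoothNear_potential hΦ hV hz)
    have hv' : restrictGerm he (hVe hz) v = y * restrictGerm he (hVe hz) u := by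
      refine (germ_eq_iff (smoothNear_inChart he (hVe hz) v)
        ((smoothNear_potential hΦ hV hz).mul (smoothNear_inChart he (hVe hz) u))).2 ?_
      filter_upwards [hV.mem_nhds hz] with q hq using hv q hq
    have hw' : restrictGerm he (hVe hz) w = germDzbar z (restrictGerm he (hVe hz) u) := by
      refine (germ_eq_iff (smoothNear_inChart he (hVe hz) w)
        (smoothNear_inChart he (hVe hz) u).dzbar).2 ?_
      filter_upwards [hV.mem_nhds hz] with q hq using hw q hq
    have key := (hG.constantCurvature he (hVe hz)).formalProd_potentialOp hd
      (PowerSeries.C (restrictGerm he (hVe hz) f)) (PowerSeries.C (restrictGerm he (hVe hz) u))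
    -- The global series v + ħw represents the germ of (∂̄Φ + ħ∂̄)u, so the axiom becomes
    -- `formalProd_potentialOp`.
    have hL : PowerSeries.map (restrictGerm he (hVe hz) : SmoothFun M →+* SmoothGerm z)
        (PowerSeries.C v + PowerSeries.X * PowerSeries.C w) =
        potentialOp (germDzbar z) y (PowerSeries.C (restrictGerm he (hVe hz) u)) := by
      rw [potentialOp_C, map_add, map_mul, PowerSeries.map_C, PowerSeries.map_C, PowerSeries.map_X]
      change PowerSeries.C (restrictGerm he (hVe hz) v) +
        PowerSeries.X * PowerSeries.C (restrictGerm he (hVe hz) w) = _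
      rw [hv', hw']
    have hS : PowerSeries.map (restrictGerm he (hVe hz) : SmoothFun M →+* SmoothGerm z)
        (starProd hG.star (PowerSeries.C f) (PowerSeries.C u)) = _ :=
      hG.map_restrictGerm_star he (hVe hz) _ _
    rw [PowerSeries.map_C, PowerSeries.map_C] at hS
    rw [inChart_coeff he (hVe hz), hG.map_restrictGerm_star, hL, PowerSeries.map_C]
    change germEval z (PowerSeries.coeff n (formalProd _ (PowerSeries.C (restrictGerm he (hVe hz) f))
      _)) = _
    rw [key]
    change _ = formalProd _ (PowerSeries.C (restrictGerm he (hVe hz) f))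
      (PowerSeries.C (restrictGerm he (hVe hz) u)) at hS
    rw [← hS]
    cases n with
    | zero =>
      rw [coeff_zero_potentialOp, map_mul, ← inChart_coeff he (hVe hz), PowerSeries.coeff_zero_X_mul,
        show inChart e (0 : SmoothFun M) = fun _ => 0 from rfl, dzbar_const, add_zero]
      rfl
    | succ n =>
      rw [coeff_succ_potentialOp, map_add, map_mul, ← inChart_coeff he (hVe hz),
        PowerSeries.coeff_succ_X_mul, PowerSeries.coeff_map]
      rfl

end Existence

/-! ### The closed formula -/

theorem coeff_starCoeff_mul (h R a b : ℂ) (m n : ℕ) :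
    PowerSeries.coeff n (starCoeff h R m * PowerSeries.C a * PowerSeries.C b) =
      tau R m n * (h ^ m * a * b) := by
  rw [starCoeff, PowerSeries.coeff_mul_C, PowerSeries.coeff_mul_C, PowerSeries.coeff_C_mul, tau]
  ring

theorem starCoeff_zero (h R : ℂ) : starCoeff h R 0 = 1 := by
  simp [starCoeff]

theorem starCoeff_succ (h R : ℂ) (n : ℕ) :
    starCoeff h R (n + 1) = PowerSeries.C h * factor R (n + 1) * starCoeff h R n := by
  rw [starCoeff, starCoeff, prod_factor_succ, pow_succ, map_mul]
  ring

variable {M : Type*} [TopologicalSpace M] [ChartedSpace ℂ M] {G : KahlerMetric M}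
  {e : OpenPartialHomeomorph M ℂ}

/-- Convergence is coefficientwise in ħ, and each coefficient is a finite sum because `tau` vanishes
for m > n. -/
theorem KahlerMetric.IsLocallySymmetric.hasSum_star [IsManifold 𝓘(ℂ) ω M]
    (hG : G.IsLocallySymmetric) (he : IsHolChart M e) {p : M} (hp : p ∈ e.source)
    (f g : SmoothFun M) :
    HasSum (fun n : ℕ => starCoeff (G.g e (e p)) (G.curvatureFun p) n
        * PowerSeries.C (((G.Dbar e)^[n] (inChart e f)) (e p))
        * PowerSeries.C (((G.D e)^[n] (inChart e g)) (e p)))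
      (evalAt p (starProd hG.star (PowerSeries.C f) (PowerSeries.C g))) := by
  rw [PowerSeries.WithPiTopology.hasSum_iff_hasSum_coeff]
  intro n
  have h := hG.inChart_star he n f g (e.map_source hp)
  rw [G.localStar_apply, inChart, e.left_inv hp] at h
  rw [evalAt, PowerSeries.coeff_mk, starProd_eq_formalProd, coeff_formalProd_C_C, h]
  simp only [coeff_starCoeff_mul]
  refine hasSum_sum_of_ne_finset_zero fun m hm => ?_
  rw [tau_eq_zero _ (by simpa using hm), zero_mul]

end KahlerStar

end

open KahlerStar in
theorem mainTheorem4 {M : Type*} [TopologicalSpace M] [T2Space M] [ChartedSpace ℂ M]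
    [IsManifold 𝓘(ℂ) ω M] (G : KahlerMetric M) (hG : G.IsLocallySymmetric) :
    (∃! C : ℕ → SmoothFun M →ₗ[ℂ] SmoothFun M →ₗ[ℂ] SmoothFun M,
      IsStarProductWithSeparation G C) ∧
    ∃ R : M → ℝ, IsLocallyConstant R ∧
      (∀ e, IsHolChart M e → ∀ p ∈ e.source,
        curvatureComponent (G.g e) (e p) = (R p : ℂ)) ∧
      ∀ C : ℕ → SmoothFun M →ₗ[ℂ] SmoothFun M →ₗ[ℂ] SmoothFun M,
        IsStarProductWithSeparation G C →
        ∀ e, IsHolChart M e → ∀ p ∈ e.source,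
          (∀ f g : SmoothFun M,
            HasSum
              (fun n : ℕ => starCoeff (G.g e (e p)) (R p) n
                * PowerSeries.C (((G.Dbar e)^[n] (inChart e f)) (e p))
                * PowerSeries.C (((G.D e)^[n] (inChart e g)) (e p)))
              (evalAt p (starProd C (PowerSeries.C f) (PowerSeries.C g)))) ∧
          starCoeff (G.g e (e p)) (R p) 0 = 1 ∧
          ∀ n : ℕ, 1 ≤ n →
            starCoeff (G.g e (e p)) (R p) n =
              PowerSeries.C (G.g e (e p)) * factor (R p) n
                * starCoeff (G.g e (e p)) (R p) (n - 1) := by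
  refine ⟨⟨hG.star, hG.isStarProduct_star, fun C hC => hC.unique hG.isStarProduct_star⟩,
    G.curvatureFun, hG.isLocallyConstant, fun e he p hp => ?_, fun C hC e he p hp => ?_⟩
  · rw [G.curvatureComponent_eq_curvatureFun he (e.map_source hp), e.left_inv hp]
  -- By uniqueness an arbitrary star product with separation of variables is the one built from the
  -- formula.
  · obtain rfl := hC.unique hG.isStarProduct_star
    refine ⟨hG.hasSum_star he hp, starCoeff_zero _ _, fun n hn => ?_⟩
    obtain ⟨n, rfl⟩ := Nat.exists_eq_add_of_le' hn
    exact starCoeff_succ _ _ n
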